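/- Let $R$ be a commutative noetherian ring that is Gorenstein, i.e. for every prime ideal $\mathfrak p$ the local ring $R_{\mathfrak p}$ has finite injective dimension as a module over itself. Let $\mathcal G$ be the collection of finitely generated Gorenstein projective $R$-modules (modules isomorphic to a module of cycles of an acyclic complex $P$ of projective $R$-modules such that $\operatorname{Hom}_R(P,Q)$ is acyclic for every projective $R$-module $Q$). For an $R$-complex $M$, let $\operatorname{level}_{\mathcal G}(M)\in\mathbb N\cup\{\infty\}$ be the least $n$ such that $M$ is in $\mathcal T_n$ (and $\infty$ if there is none), where: $\mathcal T_0$ consists of the zero objects of the derived category; $\mathcal T_1$ consists of the objects that can be built from $\mathcal G$ (modules being viewed as complexes concentrated in degree $0$) using shifts, finite direct sums and direct summands; and for $n\ge 2$, $\mathcal T_n$ consists of the objects $M$ for which there is an exact triangle $K\to L\oplus M\to N\to \Sigma K$ with $K\in\mathcal T_1$ and $N\in\mathcal T_{n-1}$. Then every complex $M$ in $\mathrm D^{\mathrm b}_{\mathrm f}(R)$, i.e. every $R$-complex with bounded and degreewise finitely generated homology, satisfies $$\operatorname{level}_{\mathcal G}(M)\le\max\{2,\ \dim R+1\},$$ where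 $\dim R$ is the Krull dimension of $R$ (possibly infinite). -/

import Mathlib

open CategoryTheory Limits

universe w v u

/-- The objects that can be built from the class `C` using shifts, finite direct sums and direct
summands. -/
def built {T : Type u} [Category.{v} T] [HasShift T ℤ] (C : ObjectProperty T) : ObjectProperty T :=
  (C.shiftClosure ℤ).binaryProductsClosure.retractClosure

/-- For a class `C` of objects of a triangulated category `T`, the classes `thick C n`:
* `thick C 0` consists of the zero objects;
* `thick C 1` consists of the objects that can be built from `C` using shifts, finite direct sums
  and direct summands;
* `thick C (n + 2)` consists of the objects `M` for which there are an object `L` and an exact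
  triangle `K ⟶ L ⊞ M ⟶ N ⟶ K⟦1⟧` with `K` in `thick C 1` and `N` in `thick C (n + 1)`. -/
def thick {T : Type u} [Category.{v} T] [HasZeroObject T] [HasShift T ℤ] [Preadditive T]
    [∀ n : ℤ, (shiftFunctor T n).Additive] [Pretriangulated T] (C : ObjectProperty T) :
    ℕ → ObjectProperty T
  | 0 => fun M => IsZero M
  | 1 => built C
  | n + 2 => fun M => ∃ (K L N : T) (f : K ⟶ L ⊞ M) (g : L ⊞ M ⟶ N) (h : N ⟶ K⟦(1 : ℤ)⟧),
      Pretriangulated.Triangle.mk f g h ∈ Pretriangulated.distinguishedTriangles ∧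
        built C K ∧ thick C (n + 1) N

/-- The level of `M` with respect to `C`: the least `n` such that `M` belongs to `thick C n`,
and `⊤` if there is no such `n`. -/
noncomputable def level {T : Type u} [Category.{v} T] [HasZeroObject T] [HasShift T ℤ]
    [Preadditive T] [∀ n : ℤ, (shiftFunctor T n).Additive] [Pretriangulated T]
    (C : ObjectProperty T) (M : T) : ℕ∞ :=
  ⨅ (n : ℕ) (_ : thick C n M), (n : ℕ∞)

/-- A totally acyclic complex of projective modules: an acyclic complex `P` of projective modules
such that the complex `Hom(P, Q)` is acyclic for every projective module `Q`. -/
structure IsTotallyAcyclic {R : Type u} [CommRing R]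
    (P : CochainComplex (ModuleCat.{u} R) ℤ) : Prop where
  projective : ∀ i : ℤ, Module.Projective R (P.X i)
  acyclic : P.Acyclic
  hom_acyclic : ∀ Q : ModuleCat.{u} R, Module.Projective R Q → ∀ (i : ℤ) (f : P.X i ⟶ Q),
    P.d (i - 1) i ≫ f = 0 → ∃ g : P.X (i + 1) ⟶ Q, P.d i (i + 1) ≫ g = f

/-- A module is Gorenstein projective if it is isomorphic to a module of cycles of a totally
acyclic complex of projective modules. (As shifts of totally acyclic complexes are totally
acyclic, it does not matter which degree is taken, nor whether one takes cycles or cokernels.) -/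
def IsGorensteinProjective {R : Type u} [CommRing R] (G : ModuleCat.{u} R) : Prop :=
  ∃ P : CochainComplex (ModuleCat.{u} R) ℤ, IsTotallyAcyclic P ∧ Nonempty (G ≅ P.cycles 0)

/-- The finitely generated Gorenstein projective `R`-modules. -/
def fgGorensteinProjective (R : Type u) [CommRing R] : ObjectProperty (ModuleCat.{u} R) :=
  fun G => Module.Finite R G ∧ IsGorensteinProjective G

/-- The finitely generated Gorenstein projective `R`-modules, as complexes concentrated in
degree `0`, in the derived category of `R`-modules. -/
noncomputable def gorensteinProjectiveClass (R : Type u) [CommRing R]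
    [HasDerivedCategory.{w} (ModuleCat.{u} R)] :
    ObjectProperty (DerivedCategory (ModuleCat.{u} R)) :=
  (fgGorensteinProjective R).map (DerivedCategory.singleFunctor (ModuleCat.{u} R) 0)

/-- The level with respect to the finitely generated Gorenstein projective modules. -/
noncomputable def gLevel {R : Type u} [CommRing R] [HasDerivedCategory.{w} (ModuleCat.{u} R)]
    (M : DerivedCategory (ModuleCat.{u} R)) : ℕ∞ :=
  level (gorensteinProjectiveClass R) M

/-- The bounded derived category of complexes with degreewise finitely generated homology, as a
class of objects of the derived category of all `R`-modules: the homology of `M` is bounded, and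
it is finitely generated in each degree. -/
def derivedBoundedFinite (R : Type u) [CommRing R] [HasDerivedCategory.{w} (ModuleCat.{u} R)] :
    ObjectProperty (DerivedCategory (ModuleCat.{u} R)) :=
  fun M => (∃ a b : ℤ, M.IsGE a ∧ M.IsLE b) ∧
    ∀ i : ℤ, Module.Finite R ((DerivedCategory.homologyFunctor (ModuleCat.{u} R) i).obj M)

/-- A commutative noetherian ring is Gorenstein if each of its localizations at a prime ideal has
finite injective dimension as a module over itself. -/
def IsGorensteinRing (R : Type u) [CommRing R] [IsNoetherianRing R] : Prop :=
  ∀ (p : Ideal R) [p.IsPrime], ∃ n : ℕ,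
    HasInjectiveDimensionLE
      (ModuleCat.of (Localization.AtPrime p) (Localization.AtPrime p)) n

/-! Let `d` be the Krull dimension of `R`; if it is infinite the bound is vacuous. Otherwise the
local finiteness hypothesis forces `R` to have injective dimension at most `d` over itself
(`IsGorensteinRing.hasInjectiveDimensionLE`), so `Ext^i(N, R) = 0` for every module `N` and every `i
> d`. Moreover, a finitely generated `N` with `Ext^i(N, R) = 0` for all `i > 0` is Gorenstein
projective: such modules are reflexive and stable under duals and syzygies, so free covers of `N` on
one side and dualized free covers of its dual on the other splice into a totally acyclic complex
(`fgGorensteinProjective_of_extSelfLE`).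

Suppose first that the homology `H` of `M` has no `Ext` into `R` above degree `1`. Represent `M` by
a bounded complex `F` of finitely generated modules, projective wherever the differential is not
injective. Descending through the degrees, the sequences `0 → B → Z → H → 0` and `0 → Z → F → B → 0`
show that boundaries and cycles have no higher `Ext` into `R` (`extSelfLE_cycles`). Hence `F` is an
extension of two complexes with zero differential and Gorenstein projective terms, and the level is
at most `2`.

Each further degree of `Ext` costs one level: a map to `M` from a sum of shifted free modules that
is surjective on homology has a cone whose homology consists of first syzygies of that of `M`, which
lowers the `Ext` bound by one (`thick_of_extSelfLE`). -/

/-! ### Vanishing of `Ext` and injective dimension -/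

section ExtVanishing

open Abelian

variable {R : Type u} [CommRing R]

/-- The vanishing of `Ext^i(N, M)` for unbundled modules. -/
def ExtZero (R : Type u) [CommRing R] (N M : Type u) [AddCommGroup N] [Module R N]
    [AddCommGroup M] [Module R M] (i : ℕ) : Prop :=
  Subsingleton (Ext (ModuleCat.of R N) (ModuleCat.of R M) i)

variable {A B C M : Type u} [AddCommGroup A] [Module R A] [AddCommGroup B] [Module R B]
  [AddCommGroup C] [Module R C] [AddCommGroup M] [Module R M]

/-- The short complex of modules attached to a pair of linear maps forming an exact sequence. -/
abbrev exactShortComplex (f : A →ₗ[R] B) (g : B →ₗ[R] C) (h : Function.Exact f g) :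
    ShortComplex (ModuleCat.{u} R) :=
  ModuleCat.shortComplexOfCompEqZero f g h.linearMap_comp_eq_zero

lemma exactShortComplex_shortExact {f : A →ₗ[R] B} {g : B →ₗ[R] C} (h : Function.Exact f g)
    (hf : Function.Injective f) (hg : Function.Surjective g) :
    (exactShortComplex f g h).ShortExact :=
  ModuleCat.shortComplex_shortExact _ h hf hg

namespace ExtZero

lemma of_middle {f : A →ₗ[R] B} {g : B →ₗ[R] C} (h : Function.Exact f g)
    (hf : Function.Injective f) (hg : Function.Surjective g) {i : ℕ}
    (hA : ExtZero R A M i) (hC : ExtZero R C M i) : ExtZero R B M i := by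
  refine ⟨fun x y ↦ ?_⟩
  rw [← sub_eq_zero]
  obtain ⟨z, hz⟩ := Ext.contravariant_sequence_exact₂ (exactShortComplex_shortExact h hf hg) _
    (x - y) (hA.elim _ _)
  rw [← hz, hC.elim z 0, Ext.comp_zero]

lemma of_left {f : A →ₗ[R] B} {g : B →ₗ[R] C} (h : Function.Exact f g)
    (hf : Function.Injective f) (hg : Function.Surjective g) {i : ℕ}
    (hB : ExtZero R B M i) (hC : ExtZero R C M (i + 1)) : ExtZero R A M i := by
  refine ⟨fun x y ↦ ?_⟩
  rw [← sub_eq_zero]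
  obtain ⟨z, hz⟩ := Ext.contravariant_sequence_exact₁ (exactShortComplex_shortExact h hf hg) _
    (x - y) (add_comm 1 i) (hC.elim _ _)
  rw [← hz, hB.elim z 0, Ext.comp_zero]

lemma of_right {f : A →ₗ[R] B} {g : B →ₗ[R] C} (h : Function.Exact f g)
    (hf : Function.Injective f) (hg : Function.Surjective g) {i : ℕ}
    (hA : ExtZero R A M i) (hB : ExtZero R B M (i + 1)) : ExtZero R C M (i + 1) := by
  refine ⟨fun x y ↦ ?_⟩
  rw [← sub_eq_zero]
  obtain ⟨z, hz⟩ := Ext.contravariant_sequence_exact₃ (exactShortComplex_shortExact h hf hg) _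
    (x - y) (hB.elim _ _) (add_comm 1 i)
  rw [← hz, hA.elim z 0, Ext.comp_zero]

lemma of_projective [Module.Projective R A] (i : ℕ) : ExtZero R A M (i + 1) := by
  have : Projective (ModuleCat.of R A) := (IsProjective.iff_projective A).1 inferInstance
  exact ⟨fun x y ↦ (Ext.eq_zero_of_projective x).trans (Ext.eq_zero_of_projective y).symm⟩

lemma of_subsingleton [Subsingleton A] (i : ℕ) : ExtZero R A M i := by
  refine ⟨fun x y ↦ ?_⟩
  have h0 : 𝟙 (ModuleCat.of R A) = 0 := by ext x; exact Subsingleton.elim _ _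
  rw [← Ext.mk₀_id_comp x, ← Ext.mk₀_id_comp y, h0, Ext.mk₀_zero, Ext.zero_comp, Ext.zero_comp]

lemma of_equiv (e : A ≃ₗ[R] B) {i : ℕ} (h : ExtZero R A M i) : ExtZero R B M i := by
  refine of_middle (C := PUnit.{u + 1}) (f := e.toLinearMap) (g := 0) ?_ e.injective ?_ h
    (of_subsingleton i)
  · intro x
    simp
  · intro x
    exact ⟨0, Subsingleton.elim _ _⟩

/-- The obstruction to extending `φ` is its image under the connecting map to `Ext^1(C, M)`. -/
lemma exists_extension {f : A →ₗ[R] B} {g : B →ₗ[R] C} (h : Function.Exact f g)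
    (hf : Function.Injective f) (hg : Function.Surjective g)
    (hC : ExtZero R C M 1) (φ : A →ₗ[R] M) : ∃ ψ : B →ₗ[R] M, ψ ∘ₗ f = φ := by
  obtain ⟨z, hz⟩ := Ext.contravariant_sequence_exact₁ (exactShortComplex_shortExact h hf hg)
    (ModuleCat.of R M) (Ext.mk₀ (ModuleCat.ofHom φ)) (add_comm 1 0) (hC.elim _ _)
  obtain ⟨ψ, rfl⟩ := Ext.homEquiv₀.symm.surjective z
  refine ⟨ψ.hom, ?_⟩
  simp only [Ext.homEquiv₀_symm_apply, Ext.mk₀_comp_mk₀] at hz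
  have := Ext.homEquiv₀.symm.injective hz
  exact congrArg ModuleCat.Hom.hom this

end ExtZero

/-- A module `M` over which all `Ext^{t+1}` from finitely generated modules vanish has injective
dimension at most `t`. -/
lemma hasInjectiveDimensionLE_of_extZero (t : ℕ) (M : ModuleCat.{u} R)
    (h : ∀ (N : Type u) [AddCommGroup N] [Module R N] [Module.Finite R N],
      ExtZero R N M (t + 1)) : HasInjectiveDimensionLE M t := by
  induction t generalizing M with
  | zero =>
    rw [HasInjectiveDimensionLE, zero_add, ← injective_iff_hasInjectiveDimensionLT_one,
      ← Module.injective_iff_injective_object R M, ← Module.Baer.iff_injective]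
    -- Baer's criterion: `Ext^1(R/I, M) = 0` lets maps from the ideal `I` extend to `R`.
    intro I g
    obtain ⟨ψ, hψ⟩ := ExtZero.exists_extension (f := Submodule.subtype I) (g := I.mkQ)
      (LinearMap.exact_subtype_mkQ I) I.injective_subtype I.mkQ_surjective (h (R ⧸ I)) g
    exact ⟨ψ, fun x hx ↦ LinearMap.congr_fun hψ ⟨x, hx⟩⟩
  | succ n ih =>
    obtain ⟨I, hI, f, hf⟩ := EnoughInjectives.presentation M
    let S := ShortComplex.mk f (cokernel.π f) (cokernel.condition f)
    have hS : S.ShortExact := { exact := ShortComplex.exact_cokernel f }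
    -- Dimension shifting: the cokernel of an embedding of `M` into an injective inherits the
    -- vanishing one degree lower.
    refine (hS.hasInjectiveDimensionLT_X₃_iff n inferInstance).1 (ih _ ?_)
    intro N _ _ _
    refine ⟨fun x y ↦ ?_⟩
    rw [← sub_eq_zero]
    obtain ⟨z, hz⟩ := Ext.covariant_sequence_exact₃ (ModuleCat.of R N) hS (x - y) rfl
      ((h N).elim _ _)
    rw [← hz, Ext.eq_zero_of_injective z, Ext.zero_comp]

lemma extZero_of_hasInjectiveDimensionLE {t : ℕ} [HasInjectiveDimensionLE (ModuleCat.of R M) t]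
    {i : ℕ} (hi : t < i) : ExtZero R A M i :=
  HasInjectiveDimensionLT.subsingleton _ (t + 1) i hi _

/-! ### Injective dimension over a noetherian local ring -/

section Local

open scoped Pointwise

variable {S : Type u} [CommRing S] [IsLocalRing S] [IsNoetherianRing S]
  {M : Type u} [AddCommGroup M] [Module S M] [Module.Finite S M]

/-- If `x` is in the maximal ideal and is a nonzerodivisor on `N`, and if
`Ext^{i+1}(N/xN, M)` vanishes, then so does `Ext^i(N, M)`. -/
lemma extZero_of_isSMulRegular {N : Type u} [AddCommGroup N] [Module S N] [Module.Finite S N]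
    {x : S} (hx : x ∈ IsLocalRing.maximalIdeal S) (hreg : IsSMulRegular N x) {i : ℕ}
    (h : ExtZero S (N ⧸ LinearMap.range (LinearMap.lsmul S N x)) M (i + 1)) :
    ExtZero S N M i := by
  have hex : Function.Exact (LinearMap.lsmul S N x) (LinearMap.range (LinearMap.lsmul S N x)).mkQ :=
    LinearMap.exact_map_mkQ_range _
  have hS := exactShortComplex_shortExact hex hreg (Submodule.mkQ_surjective _)
  -- Vanishing in degree `i + 1` makes multiplication by `x` surjective on `Ext^i(N, M)`. This
  -- module is finitely generated, so Nakayama's lemma kills it.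
  have htop : (⊤ : Submodule S (Ext (ModuleCat.of S N) (ModuleCat.of S M) i)) ≤
      IsLocalRing.maximalIdeal S • ⊤ := by
    intro e _
    obtain ⟨z, hz⟩ := Ext.contravariant_sequence_exact₁ hS (ModuleCat.of S M) e (add_comm 1 i)
      (h.elim _ _)
    have : (Ext.mk₀ (exactShortComplex _ _ hex).f).comp z (zero_add i) = x • z := by
      have h1 : (exactShortComplex _ _ hex).f = x • 𝟙 (ModuleCat.of S N) := rfl
      rw [h1, Ext.mk₀_smul, Ext.smul_comp, Ext.mk₀_id_comp]
    rw [← hz, this]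
    exact Submodule.smul_mem_smul hx trivial
  have hbot : (⊤ : Submodule S (Ext (ModuleCat.of S N) (ModuleCat.of S M) i)) = ⊥ :=
    Submodule.eq_bot_of_le_smul_of_le_jacobson_bot _ _ Module.Finite.fg_top htop
      (IsLocalRing.maximalIdeal_le_jacobson _)
  exact (Submodule.subsingleton_iff S).1 (subsingleton_of_bot_eq_top hbot.symm)

/-- By dévissage it suffices to treat `S/p` with `p` prime. If `p` is not maximal, an element of the
maximal ideal outside `p` is regular on `S/p`, and the vanishing in degree `n + 1` descends to
degree `n`. -/
lemma extZero_of_extZero_residueField {n : ℕ}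
    (hk : ExtZero S (IsLocalRing.ResidueField S) M n)
    (h : ∀ (N : Type u) [AddCommGroup N] [Module S N] [Module.Finite S N],
      ExtZero S N M (n + 1))
    (N : Type u) [AddCommGroup N] [Module S N] [hN : Module.Finite S N] : ExtZero S N M n := by
  induction hN using IsNoetherianRing.induction_on_isQuotientEquivQuotientPrime S with
  | subsingleton N => exact .of_subsingleton n
  | quotient N p e =>
    refine .of_equiv e.symm ?_
    by_cases hp : IsLocalRing.maximalIdeal S ≤ p.1
    · have : p.1 = IsLocalRing.maximalIdeal S :=
        le_antisymm (IsLocalRing.le_maximalIdeal p.2.ne_top) hp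
      rw [this]
      exact hk
    · obtain ⟨x, hx, hxp⟩ := SetLike.not_le_iff_exists.1 hp
      refine extZero_of_isSMulRegular hx ?_ (h _)
      intro a b hab
      obtain ⟨a, rfl⟩ := Ideal.Quotient.mk_surjective a
      obtain ⟨b, rfl⟩ := Ideal.Quotient.mk_surjective b
      have hab' : Ideal.Quotient.mk p.1 (x * a) = Ideal.Quotient.mk p.1 (x * b) := hab
      rw [Ideal.Quotient.eq, ← mul_sub] at hab'
      exact Ideal.Quotient.eq.2 ((p.2.mem_or_mem hab').resolve_left hxp)
  | exact N₁ N₂ N₃ f g hf hg hfg h₁ h₃ => exact .of_middle hfg hf hg h₁ h₃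

/-- Over a local ring, finite injective dimension `t` drops to `r` if some finitely generated
module containing the residue field has no `Ext` above degree `r`. -/
lemma hasInjectiveDimensionLE_of_injective_residueField {N : Type u} [AddCommGroup N] [Module S N]
    [Module.Finite S N] (f : IsLocalRing.ResidueField S →ₗ[S] N) (hf : Function.Injective f)
    {r t : ℕ} (hN : ∀ i, r < i → ExtZero S N M i)
    (ht : HasInjectiveDimensionLE (ModuleCat.of S M) t) :
    HasInjectiveDimensionLE (ModuleCat.of S M) r := by
  induction t with
  | zero => exact hasInjectiveDimensionLT_of_ge _ 1 _ (by lia)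
  | succ t ih =>
    by_cases hrt : t + 1 ≤ r
    · exact hasInjectiveDimensionLT_of_ge _ (t + 1 + 1) _ (by lia)
    refine ih (hasInjectiveDimensionLE_of_extZero t _ fun N' _ _ _ ↦ ?_)
    refine extZero_of_extZero_residueField ?_ (fun N'' _ _ _ ↦
      extZero_of_hasInjectiveDimensionLE (Nat.lt_succ_self _)) N'
    -- `Ext^{t+1}` of the residue field sits between `Ext^{t+1}(N, M)`, zero since `r < t + 1`, and
    -- `Ext^{t+2}` of the cokernel of `f`, zero by the current bound on the injective dimension.
    exact .of_left (LinearMap.exact_map_mkQ_range f) hf (Submodule.mkQ_surjective _)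
      (hN (t + 1) (by lia)) (extZero_of_hasInjectiveDimensionLE (Nat.lt_succ_self _))

/-- Either the residue field embeds in `N`, and the injective dimension is at most `r`, or the
maximal ideal contains an `N`-regular element `x`. In the second case `N/xN` has dimension one less
and `Ext` bound one more, so `k + r` is preserved and the induction on `k` continues. -/
lemma hasInjectiveDimensionLE_of_supportDim_add_le {d t : ℕ}
    (ht : HasInjectiveDimensionLE (ModuleCat.of S M) t) (k r : ℕ) (hkr : k + r ≤ d)
    (N : Type u) [AddCommGroup N] [Module S N] [Module.Finite S N] [Nontrivial N]
    (hN : ∀ i, r < i → ExtZero S N M i) (hdim : Module.supportDim S N ≤ k) :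
    HasInjectiveDimensionLE (ModuleCat.of S M) d := by
  induction k using Nat.strong_induction_on generalizing r N with | _ k ih =>
  have key : Subsingleton (IsLocalRing.ResidueField S →ₗ[S] N) ∨
      HasInjectiveDimensionLE (ModuleCat.of S M) r := by
    refine or_iff_not_imp_left.2 fun h ↦ ?_
    rw [not_subsingleton_iff_nontrivial] at h
    obtain ⟨f, hf⟩ := exists_ne (0 : IsLocalRing.ResidueField S →ₗ[S] N)
    have : IsSimpleModule S (IsLocalRing.ResidueField S) :=
      isSimpleModule_iff_quot_maximal.2
        ⟨IsLocalRing.maximalIdeal S, inferInstance, ⟨LinearEquiv.refl _ _⟩⟩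
    exact hasInjectiveDimensionLE_of_injective_residueField f
      (LinearMap.injective_of_ne_zero hf) hN ht
  rcases key with hsub | h
  swap
  · exact hasInjectiveDimensionLT_of_ge _ (r + 1) _ (by lia)
  obtain ⟨x, hx, hreg⟩ := IsSMulRegular.subsingleton_linearMap_iff.1 hsub
  have hxm : x ∈ IsLocalRing.maximalIdeal S := by
    have h1 := Ideal.annihilator_quotient (I := IsLocalRing.maximalIdeal S)
    exact h1 ▸ hx
  have hxj : x ∈ (Module.annihilator S N).jacobson :=
    IsLocalRing.maximalIdeal_le_jacobson _ hxm
  have hdim' := Module.supportDim_quotSMulTop_succ_eq_supportDim_mem_jacobson hreg hxj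
  have hnt : Nontrivial (QuotSMulTop x N) := Submodule.Quotient.nontrivial_iff.2
    (Submodule.top_ne_pointwise_smul_of_mem_jacobson_annihilator hxj).symm
  have hex : Function.Exact (LinearMap.lsmul S N x) (Submodule.mkQ (x • (⊤ : Submodule S N))) := by
    intro y
    simp [Submodule.mem_smul_pointwise_iff_exists]
  have hN' : ∀ i, r + 1 < i → ExtZero S (QuotSMulTop x N) M i := by
    intro i hi
    obtain ⟨i, rfl⟩ : ∃ j, i = j + 1 := ⟨i - 1, by lia⟩
    exact .of_right hex hreg (Submodule.mkQ_surjective _) (hN i (by lia)) (hN (i + 1) (by lia))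
  have hbot := Module.supportDim_ne_bot_of_nontrivial S (QuotSMulTop x N)
  rw [← hdim'] at hdim
  obtain ⟨s, hs⟩ := WithBot.ne_bot_iff_exists.1 hbot
  rw [← hs] at hdim
  have hdim2 : s + 1 ≤ (k : ℕ∞) := by exact_mod_cast hdim
  -- The quotient is nonzero, so its dimension `s` is not `⊥`, and `s + 1 ≤ k` rules out `k = 0`.
  obtain ⟨n, rfl⟩ : ∃ n, k = n + 1 := by
    refine ⟨k - 1, ?_⟩
    rcases k with _ | k
    · simp at hdim2
    · rfl
  refine ih n (by lia) (r + 1) (by lia) (QuotSMulTop x N) hN' ?_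
  rw [← hs]
  push_cast at hdim2
  exact_mod_cast (ENat.add_le_add_iff_right ENat.one_ne_top).1 hdim2

lemma IsLocalRing.hasInjectiveDimensionLE_self {d t : ℕ} (hd : ringKrullDim S ≤ d)
    (ht : HasInjectiveDimensionLE (ModuleCat.of S S) t) :
    HasInjectiveDimensionLE (ModuleCat.of S S) d := by
  refine hasInjectiveDimensionLE_of_supportDim_add_le ht d 0 le_rfl S ?_
    (by rwa [Module.supportDim_self_eq_ringKrullDim])
  intro i hi
  obtain ⟨i, rfl⟩ : ∃ j, i = j + 1 := ⟨i - 1, by lia⟩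
  exact .of_projective i

end Local

/-- A Gorenstein ring of Krull dimension at most `d` has injective dimension at most `d`. -/
lemma IsGorensteinRing.hasInjectiveDimensionLE [IsNoetherianRing R] (hR : IsGorensteinRing R)
    {d : ℕ} (hd : ringKrullDim R ≤ d) : HasInjectiveDimensionLE (ModuleCat.of R R) d := by
  -- The local bounds given by `hR` may vary with the maximal ideal; each is first replaced by the
  -- uniform bound `d`.
  rw [ModuleCat.hasInjectiveDimensionLE_iff_forall_maximalSpectrum]
  intro m
  obtain ⟨t, ht⟩ := hR m.1
  have := IsLocalRing.hasInjectiveDimensionLE_self (d := d)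
    (by
      rw [IsLocalization.AtPrime.ringKrullDim_eq_height m.1 (Localization.AtPrime m.1)]
      exact (Ideal.height_le_ringKrullDim_of_ne_top m.2.ne_top).trans hd) ht
  refine (ModuleCat.hasInjectiveDimensionLE_iff_of_linearEquiv (M := ModuleCat.of _ _) ?_ d).1 this
  exact (Shrink.linearEquiv _ _).symm

end ExtVanishing

/-! ### Modules without higher `Ext` into the ring are Gorenstein projective -/

section GorensteinProjective

variable {R : Type u} [CommRing R]

/-- The vanishing of `Ext^i(N, R)` for all `i > k`. -/
def ExtSelfLE (R : Type u) [CommRing R] (N : Type u) [AddCommGroup N] [Module R N] (k : ℕ) : Prop :=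
  ∀ i, k < i → ExtZero R N R i

variable {A B C : Type u} [AddCommGroup A] [Module R A] [AddCommGroup B] [Module R B]
  [AddCommGroup C] [Module R C]

namespace ExtSelfLE

lemma mono {k l : ℕ} (h : ExtSelfLE R A k) (hkl : k ≤ l) : ExtSelfLE R A l :=
  fun i hi ↦ h i (hkl.trans_lt hi)

lemma of_projective [Module.Projective R A] (k : ℕ) : ExtSelfLE R A k := by
  intro i hi
  obtain ⟨i, rfl⟩ : ∃ j, i = j + 1 := ⟨i - 1, by lia⟩
  exact .of_projective i

lemma of_equiv (e : A ≃ₗ[R] B) {k : ℕ} (h : ExtSelfLE R A k) : ExtSelfLE R B k :=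
  fun i hi ↦ (h i hi).of_equiv e

lemma of_subsingleton [Subsingleton A] (k : ℕ) : ExtSelfLE R A k :=
  fun i _ ↦ .of_subsingleton i

lemma of_left {f : A →ₗ[R] B} {g : B →ₗ[R] C} (h : Function.Exact f g)
    (hf : Function.Injective f) (hg : Function.Surjective g) {k : ℕ}
    (hB : ExtSelfLE R B k) (hC : ExtSelfLE R C (k + 1)) : ExtSelfLE R A k :=
  fun i hi ↦ .of_left h hf hg (hB i hi) (hC (i + 1) (by lia))

end ExtSelfLE

section Dual

variable {f : A →ₗ[R] B} {g : B →ₗ[R] C}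

lemma dualMap_exact (h : Function.Exact f g) (hg : Function.Surjective g) :
    Function.Exact g.dualMap f.dualMap := by
  intro φ
  constructor
  · intro hφ
    have hker : LinearMap.ker g ≤ LinearMap.ker φ := by
      intro b hb
      obtain ⟨a, rfl⟩ := (h b).1 hb
      exact LinearMap.congr_fun hφ a
    refine ⟨(LinearMap.ker g).liftQ φ hker ∘ₗ
      (g.quotKerEquivOfSurjective hg).symm.toLinearMap, ?_⟩
    ext b
    have : (g.quotKerEquivOfSurjective hg).symm (g b) = Submodule.Quotient.mk b := by
      rw [LinearEquiv.symm_apply_eq]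
      rfl
    simp [this]
  · rintro ⟨ψ, rfl⟩
    ext a
    simp [h.apply_apply_eq_zero a]

lemma dualMap_surjective_of_extSelfLE (h : Function.Exact f g) (hf : Function.Injective f)
    (hg : Function.Surjective g) (hC : ExtSelfLE R C 0) : Function.Surjective f.dualMap := by
  intro φ
  obtain ⟨ψ, hψ⟩ := (hC 1 one_pos).exists_extension h hf hg φ
  exact ⟨ψ, hψ⟩

end Dual

/-! ### Duality and syzygies in finite injective dimension -/

section Noetherian

variable [IsNoetherianRing R]

instance (K : Type u) [AddCommGroup K] [Module R K] [Module.Finite R K] :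
    Module.Finite R (Module.Dual R K) := by
  obtain ⟨n, f, hf⟩ := Module.Finite.exists_fin' R K
  exact Module.Finite.of_injective f.dualMap (LinearMap.dualMap_injective_of_surjective hf)

variable {d : ℕ} (hR : HasInjectiveDimensionLE (ModuleCat.of R R) d)

include hR in
-- Dualizing `0 → Ω → F → K → 0`, with `F` free, gives an exact sequence `0 → K* → F* → Ω* → 0`, so
-- vanishing of `Ext^{i+1}(Ω*, R)` gives that of `Ext^i(K*, R)`. As `Ω` satisfies the same
-- hypothesis as `K`, the degree can be raised until it exceeds `d`.
lemma extSelfLE_dual {K : Type u} [AddCommGroup K] [Module R K] [Module.Finite R K]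
    (hK : ExtSelfLE R K 0) : ExtSelfLE R (Module.Dual R K) 0 := by
  suffices H : ∀ (n : ℕ) (K : Type u) [AddCommGroup K] [Module R K] [Module.Finite R K],
      ExtSelfLE R K 0 → ∀ i, 0 < i → d < i + n → ExtZero R (Module.Dual R K) R i from
    fun i hi ↦ H d K hK i hi (by lia)
  intro n
  induction n with
  | zero => exact fun K _ _ _ hK i hi hd ↦ extZero_of_hasInjectiveDimensionLE hd
  | succ n ih =>
    intro K _ _ _ hK i hi hd
    obtain ⟨m, f, hf⟩ := Module.Finite.exists_fin' R K
    have hex := LinearMap.exact_subtype_ker_map f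
    have hΩ : ExtSelfLE R (LinearMap.ker f) 0 :=
      .of_left hex (Submodule.injective_subtype _) hf (.of_projective 0) (hK.mono zero_le_one)
    exact .of_left (dualMap_exact hex hf) (LinearMap.dualMap_injective_of_surjective hf)
      (dualMap_surjective_of_extSelfLE hex (Submodule.injective_subtype _) hf hK)
      (ExtSelfLE.of_projective 0 i hi) (ih _ hΩ (i + 1) (by lia) (by lia))

include hR in
-- The dual of the syzygy has no `Ext^1`, so a free cover of `K` stays surjective after double
-- dualization; finite free modules are reflexive.
lemma dual_eval_surjective {K : Type u} [AddCommGroup K] [Module R K] [Module.Finite R K]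
    (hK : ExtSelfLE R K 0) : Function.Surjective (Module.Dual.eval R K) := by
  obtain ⟨m, f, hf⟩ := Module.Finite.exists_fin' R K
  have hex := LinearMap.exact_subtype_ker_map f
  have hΩ : ExtSelfLE R (LinearMap.ker f) 0 :=
    .of_left hex (Submodule.injective_subtype _) hf (.of_projective 0) (hK.mono zero_le_one)
  have hsurj : Function.Surjective f.dualMap.dualMap :=
    dualMap_surjective_of_extSelfLE (dualMap_exact hex hf)
      (LinearMap.dualMap_injective_of_surjective hf)
      (dualMap_surjective_of_extSelfLE hex (Submodule.injective_subtype _) hf hK)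
      (extSelfLE_dual hR hΩ)
  intro φ
  obtain ⟨ψ, rfl⟩ := hsurj φ
  obtain ⟨x, rfl⟩ := (Module.bijective_dual_eval R (Fin m → R)).2 ψ
  exact ⟨f x, rfl⟩

include hR in
-- An element of the free cover that dies in `K**` comes from `Ω**`, hence from the syzygy `Ω` by
-- surjectivity of its evaluation map, hence is zero in `K`.
lemma dual_eval_injective {K : Type u} [AddCommGroup K] [Module R K] [Module.Finite R K]
    (hK : ExtSelfLE R K 0) : Function.Injective (Module.Dual.eval R K) := by
  obtain ⟨m, f, hf⟩ := Module.Finite.exists_fin' R K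
  have hex := LinearMap.exact_subtype_ker_map f
  have hΩ : ExtSelfLE R (LinearMap.ker f) 0 :=
    .of_left hex (Submodule.injective_subtype _) hf (.of_projective 0) (hK.mono zero_le_one)
  have hex2 := dualMap_exact (dualMap_exact hex hf)
      (dualMap_surjective_of_extSelfLE hex (Submodule.injective_subtype _) hf hK)
  rw [injective_iff_map_eq_zero]
  intro k hk
  obtain ⟨x, rfl⟩ := hf k
  obtain ⟨ψ, hψ⟩ := (hex2 (Module.Dual.eval R _ x)).1 hk
  obtain ⟨y, rfl⟩ := dual_eval_surjective hR hΩ ψ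
  have hxy : Module.Dual.eval R (Fin m → R) y = Module.Dual.eval R _ x := hψ
  rw [← (Module.bijective_dual_eval R (Fin m → R)).1 hxy]
  exact y.2

variable (R) in
/-- The finitely generated modules `K` with `Ext^i(K, R) = 0` for all `i > 0`. -/
abbrev ExtSelfZeroModule : Type (u + 1) :=
  {K : ModuleCat.{u} R // Module.Finite R K ∧ ExtSelfLE R K 0}

/-- `K'` is the cokernel of an embedding of `K` into a finitely generated projective module. -/
structure SyzygyData (K K' : ModuleCat.{u} R) where
  F : ModuleCat.{u} R
  projective : Module.Projective R F
  f : K →ₗ[R] F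
  g : F →ₗ[R] K'
  injective : Function.Injective f
  surjective : Function.Surjective g
  exact : Function.Exact f g

lemma exists_syzygyData_left (K' : ExtSelfZeroModule R) :
    ∃ K : ExtSelfZeroModule R, Nonempty (SyzygyData K.1 K'.1) := by
  obtain ⟨K', hfin, hK'⟩ := K'
  obtain ⟨m, f, hf⟩ := Module.Finite.exists_fin' R K'
  have hex := LinearMap.exact_subtype_ker_map f
  exact ⟨⟨ModuleCat.of R (LinearMap.ker f), inferInstanceAs (Module.Finite R (LinearMap.ker f)),
    .of_left hex (Submodule.injective_subtype _) hf (.of_projective 0) (hK'.mono zero_le_one)⟩,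
    ⟨{ F := ModuleCat.of R (Fin m → R)
       projective := inferInstanceAs (Module.Projective R (Fin m → R))
       f := (LinearMap.ker f).subtype
       g := f
       injective := Submodule.injective_subtype _
       surjective := hf
       exact := hex }⟩⟩

include hR in
-- Dualizing a free cover of `K*` embeds `K ≅ K**` in a free module, with cokernel the dual of the
-- kernel of the cover.
lemma exists_syzygyData_right (K : ExtSelfZeroModule R) :
    ∃ K' : ExtSelfZeroModule R, Nonempty (SyzygyData K.1 K'.1) := by
  obtain ⟨K, hfin, hK⟩ := K
  obtain ⟨m, f, hf⟩ := Module.Finite.exists_fin' R (Module.Dual R K)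
  have hex := LinearMap.exact_subtype_ker_map f
  have hdual := extSelfLE_dual hR hK
  have hL : ExtSelfLE R (LinearMap.ker f) 0 :=
    .of_left hex (Submodule.injective_subtype _) hf (.of_projective 0) (hdual.mono zero_le_one)
  have hsurj := dualMap_surjective_of_extSelfLE hex (Submodule.injective_subtype _) hf hdual
  refine ⟨⟨ModuleCat.of R (Module.Dual R (LinearMap.ker f)),
    inferInstanceAs (Module.Finite R (Module.Dual R (LinearMap.ker f))), extSelfLE_dual hR hL⟩,
    ⟨{ F := ModuleCat.of R (Module.Dual R (Fin m → R))
       projective := inferInstanceAs (Module.Projective R (Module.Dual R (Fin m → R)))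
       f := f.dualMap ∘ₗ Module.Dual.eval R K
       g := (LinearMap.ker f).subtype.dualMap
       injective := (LinearMap.dualMap_injective_of_surjective hf).comp (dual_eval_injective hR hK)
       surjective := hsurj
       exact := ?_ }⟩⟩
  intro φ
  rw [dualMap_exact hex hf φ]
  constructor
  · rintro ⟨ψ, rfl⟩
    obtain ⟨x, rfl⟩ := dual_eval_surjective hR hK ψ
    exact ⟨x, rfl⟩
  · rintro ⟨x, rfl⟩
    exact ⟨_, rfl⟩

end Noetherian

/-- A relation that can be continued in both directions admits bi-infinite chains through every
element. -/
lemma exists_int_chain {α : Type*} {r : α → α → Prop} (hl : ∀ b, ∃ a, r a b)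
    (hr : ∀ a, ∃ b, r a b) (x : α) : ∃ G : ℤ → α, G 0 = x ∧ ∀ i, r (G i) (G (i + 1)) := by
  choose l hl using hl
  choose s hs using hr
  let G : ℤ → α := fun i ↦ match i with
    | Int.ofNat n => s^[n] x
    | Int.negSucc n => l^[n + 1] x
  refine ⟨G, rfl, fun i ↦ ?_⟩
  match i with
  | Int.ofNat n =>
    have : G (Int.ofNat n + 1) = s (s^[n] x) := Function.iterate_succ_apply' s n x
    rw [this]
    exact hs _
  | Int.negSucc 0 =>
    exact hl x
  | Int.negSucc (n + 1) =>
    have h1 : G (Int.negSucc (n + 1)) = l (l^[n + 1] x) := Function.iterate_succ_apply' l (n + 1) x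
    have h2 : Int.negSucc (n + 1) + 1 = Int.negSucc n := by lia
    rw [h1, h2]
    exact hl _

/-- Maps to projective modules extend along embeddings of finitely generated modules as soon as
maps to the ring do. -/
lemma exists_extension_to_projective {K F Q : Type u} [AddCommGroup K] [Module R K]
    [Module.Finite R K] [AddCommGroup F] [Module R F] [AddCommGroup Q] [Module R Q]
    [Module.Projective R Q] (f : K →ₗ[R] F) (hf : Function.Surjective f.dualMap)
    (φ : K →ₗ[R] Q) : ∃ ψ : F →ₗ[R] Q, ψ ∘ₗ f = φ := by
  classical
  obtain ⟨s, hs⟩ := Module.projective_def'.1 ‹Module.Projective R Q›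
  obtain ⟨T, hT⟩ := (Module.Finite.fg_top : (⊤ : Submodule R K).FG)
  -- As `K` is finitely generated, `s ∘ φ` involves only the finitely many coordinates in `I`. Each
  -- is a functional that extends to `F`; the retraction onto `Q` is applied afterwards.
  let I : Finset Q := T.biUnion fun t ↦ (s (φ t)).support
  have hI : ∀ x, (s (φ x)).support ⊆ I := by
    intro x
    have : (⊤ : Submodule R K) ≤
        (Finsupp.supported R R (I : Set Q)).comap (s ∘ₗ φ) := by
      rw [← hT, Submodule.span_le]
      intro t ht
      simp only [Submodule.comap_coe, Set.mem_preimage, SetLike.mem_coe, Finsupp.mem_supported]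
      exact_mod_cast Finset.subset_biUnion_of_mem (fun t ↦ (s (φ t)).support) ht
    exact_mod_cast (Finsupp.mem_supported R _).1 (this (Submodule.mem_top (x := x)))
  choose e he using hf
  let ψ : F →ₗ[R] (Q →₀ R) :=
    ∑ q ∈ I, Finsupp.lsingle q ∘ₗ e (Finsupp.lapply q ∘ₗ s ∘ₗ φ)
  refine ⟨Finsupp.linearCombination R id ∘ₗ ψ, ?_⟩
  have hψ : ∀ x, ψ (f x) = s (φ x) := by
    intro x
    have h1 : ∀ q, e (Finsupp.lapply q ∘ₗ s ∘ₗ φ) (f x) = s (φ x) q :=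
      fun q ↦ LinearMap.congr_fun (he (Finsupp.lapply q ∘ₗ s ∘ₗ φ)) x
    simp only [ψ, LinearMap.sum_apply, LinearMap.comp_apply, h1, Finsupp.lsingle_apply]
    exact (Finsupp.sum_of_support_subset _ (hI x) _ (by simp)).symm.trans (Finsupp.sum_single _)
  ext x
  simp only [LinearMap.comp_apply, hψ]
  exact LinearMap.congr_fun hs (φ x)

/-- The complex spliced from a bi-infinite chain of syzygies. -/
noncomputable def splicedComplex (G : ℤ → ModuleCat.{u} R)
    (D : ∀ i, SyzygyData (G i) (G (i + 1))) : CochainComplex (ModuleCat.{u} R) ℤ :=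
  CochainComplex.of (fun i ↦ (D i).F)
    (fun i ↦ ModuleCat.ofHom ((D (i + 1)).f ∘ₗ (D i).g)) (by
      intro i
      ext x
      simp [(D (i + 1)).exact.apply_apply_eq_zero])

section

variable (G : ℤ → ModuleCat.{u} R) (D : ∀ i, SyzygyData (G i) (G (i + 1)))

lemma splicedComplex_d (i : ℤ) :
    (splicedComplex G D).d i (i + 1) = ModuleCat.ofHom ((D (i + 1)).f ∘ₗ (D i).g) :=
  CochainComplex.of_d (fun i ↦ (D i).F)
    (fun i ↦ ModuleCat.ofHom ((D (i + 1)).f ∘ₗ (D i).g)) i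

lemma splicedComplex_acyclic : (splicedComplex G D).Acyclic := by
  intro j
  obtain ⟨i, rfl⟩ : ∃ i, j = i + 1 := ⟨j - 1, by lia⟩
  rw [HomologicalComplex.exactAt_iff' _ i (i + 1) (i + 1 + 1) (by simp) (by simp),
    ShortComplex.moduleCat_exact_iff]
  intro x hx
  change (splicedComplex G D).d (i + 1) (i + 1 + 1) x = 0 at hx
  rw [splicedComplex_d] at hx
  have hx' : (D (i + 1)).g x = 0 :=
    (injective_iff_map_eq_zero _).1 (D (i + 1 + 1)).injective _ hx
  obtain ⟨y, rfl⟩ := ((D (i + 1)).exact x).1 hx'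
  obtain ⟨z, rfl⟩ := (D i).surjective y
  refine ⟨z, ?_⟩
  change (splicedComplex G D).d i (i + 1) z = _
  rw [splicedComplex_d]
  rfl

/-- A map to `Q` that kills boundaries factors through the next syzygy in the chain. From there it
extends to the following term of the complex, since the cokernel of that embedding has no `Ext^1`
into `R`. -/
lemma isTotallyAcyclic_splicedComplex (hG : ∀ i, Module.Finite R (G i))
    (hext : ∀ i, ExtSelfLE R (G i) 0) : IsTotallyAcyclic (splicedComplex G D) where
  projective i := (D i).projective
  acyclic := splicedComplex_acyclic G D
  hom_acyclic Q hQ j φ hφ := by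
    obtain ⟨i, rfl⟩ : ∃ i, j = i + 1 := ⟨j - 1, by lia⟩
    have hφ' : (splicedComplex G D).d i (i + 1) ≫ φ = 0 := by
      have aux : ∀ k, k = i + 1 - 1 → (splicedComplex G D).d k (i + 1) ≫ φ = 0 := by
        rintro _ rfl
        exact hφ
      exact aux i (by lia)
    rw [splicedComplex_d] at hφ'
    let φ' : (D (i + 1)).F →ₗ[R] Q := φ.hom
    have h0 : ∀ x, φ' ((D (i + 1)).f x) = 0 := by
      intro x
      obtain ⟨z, rfl⟩ := (D i).surjective x
      exact LinearMap.congr_fun (congrArg ModuleCat.Hom.hom hφ') z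
    have hker : LinearMap.ker (D (i + 1)).g ≤ LinearMap.ker φ' := by
      intro y hy
      obtain ⟨x, rfl⟩ := ((D (i + 1)).exact y).1 hy
      exact h0 x
    let χ : G (i + 1 + 1) →ₗ[R] Q := (LinearMap.ker (D (i + 1)).g).liftQ φ' hker ∘ₗ
      ((D (i + 1)).g.quotKerEquivOfSurjective (D (i + 1)).surjective).symm.toLinearMap
    have hχ : ∀ y, χ ((D (i + 1)).g y) = φ' y := by
      intro y
      have : ((D (i + 1)).g.quotKerEquivOfSurjective (D (i + 1)).surjective).symm
          ((D (i + 1)).g y) = Submodule.Quotient.mk y := by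
        rw [LinearEquiv.symm_apply_eq]
        rfl
      simp [χ, this]
    obtain ⟨ψ, hψ⟩ := exists_extension_to_projective (D (i + 1 + 1)).f
      (dualMap_surjective_of_extSelfLE (D _).exact (D _).injective (D _).surjective (hext _)) χ
    refine ⟨ModuleCat.ofHom ψ, ?_⟩
    rw [splicedComplex_d]
    ext y
    exact (LinearMap.congr_fun hψ _).trans (hχ y)

lemma nonempty_iso_cycles_splicedComplex (i : ℤ) :
    Nonempty (G i ≅ (splicedComplex G D).cycles i) := by
  let S : ShortComplex (ModuleCat.{u} R) := ShortComplex.mk (X₁ := G i)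
    (X₂ := (splicedComplex G D).X i) (X₃ := (splicedComplex G D).X (i + 1))
    (ModuleCat.ofHom (D i).f) ((splicedComplex G D).d i (i + 1)) (by
      rw [splicedComplex_d]
      ext x
      change (D (i + 1)).f ((D i).g ((D i).f x)) = 0
      rw [(D i).exact.apply_apply_eq_zero, map_zero])
  have hS : S.Exact := by
    rw [ShortComplex.moduleCat_exact_iff]
    intro x hx
    change (splicedComplex G D).d i (i + 1) x = 0 at hx
    rw [splicedComplex_d] at hx
    exact ((D i).exact x).1 ((injective_iff_map_eq_zero _).1 (D (i + 1)).injective _ hx)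
  have : Mono S.f := (ModuleCat.mono_iff_injective _).2 (D i).injective
  exact ⟨hS.fIsKernel.conePointUniqueUpToIso
    ((splicedComplex G D).cyclesIsKernel i (i + 1) (by simp))⟩

end

/-- Over a noetherian ring of finite injective dimension, the finitely generated modules `K` with
`Ext^i(K, R) = 0` for all `i > 0` are Gorenstein projective. -/
lemma fgGorensteinProjective_of_extSelfLE [IsNoetherianRing R] {d : ℕ}
    (hR : HasInjectiveDimensionLE (ModuleCat.of R R) d) (K : ModuleCat.{u} R)
    [hfin : Module.Finite R K] (hK : ExtSelfLE R K 0) : fgGorensteinProjective R K := by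
  obtain ⟨G, hG0, hG⟩ := exists_int_chain
    (r := fun K K' : ExtSelfZeroModule R ↦ Nonempty (SyzygyData K.1 K'.1))
    exists_syzygyData_left (exists_syzygyData_right hR) ⟨K, hfin, hK⟩
  let D i := (hG i).some
  refine ⟨hfin, splicedComplex (fun i ↦ (G i).1) D, isTotallyAcyclic_splicedComplex _ _
    (fun i ↦ (G i).2.1) (fun i ↦ (G i).2.2), ?_⟩
  have h := nonempty_iso_cycles_splicedComplex (fun i ↦ (G i).1) D 0
  rwa [hG0] at h

end GorensteinProjective

/-! ### Cycles and homology in terms of elements -/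

section Elements

variable {R : Type u} [CommRing R] (K : CochainComplex (ModuleCat.{u} R) ℤ)

lemma iCycles_injective (i : ℤ) : Function.Injective (K.iCycles i) :=
  (ModuleCat.mono_iff_injective _).1 inferInstance

lemma homologyπ_surjective (i : ℤ) : Function.Surjective (K.homologyπ i) :=
  (ModuleCat.epi_iff_surjective _).1 inferInstance

lemma d_iCycles_apply (i j : ℤ) (c : K.cycles i) : K.d i j (K.iCycles i c) = 0 := by
  rw [← ModuleCat.comp_apply, K.iCycles_d]
  rfl

lemma iCycles_exact (i : ℤ) :
    Function.Exact (K.iCycles i).hom (K.d i (i + 1)).hom := by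
  have h : (ShortComplex.mk (K.iCycles i) (K.d i (i + 1)) (K.iCycles_d i (i + 1))).Exact :=
    ShortComplex.exact_of_f_is_kernel _ (K.cyclesIsKernel i (i + 1) (by simp))
  exact (ShortComplex.ShortExact.moduleCat_exact_iff_function_exact _).1 h

lemma exists_iCycles_eq {i : ℤ} (x : K.X i) (hx : K.d i (i + 1) x = 0) :
    ∃ c : K.cycles i, K.iCycles i c = x :=
  (iCycles_exact K i x).1 hx

lemma homologyπ_eq_zero_iff {i : ℤ} (c : K.cycles (i + 1)) :
    K.homologyπ (i + 1) c = 0 ↔ ∃ y : K.X i, K.d i (i + 1) y = K.iCycles (i + 1) c := by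
  have h : (ShortComplex.mk (K.toCycles i (i + 1)) (K.homologyπ (i + 1))
      (K.toCycles_comp_homologyπ i (i + 1))).Exact :=
    ShortComplex.exact_of_g_is_cokernel _ (K.homologyIsCokernel i (i + 1) (by simp))
  have h' := (ShortComplex.ShortExact.moduleCat_exact_iff_function_exact _).1 h c
  refine h'.trans (exists_congr fun y ↦ ?_)
  rw [← (iCycles_injective K (i + 1)).eq_iff]
  change K.iCycles (i + 1) (K.toCycles i (i + 1) y) = _ ↔ _
  rw [← ModuleCat.comp_apply, K.toCycles_i]

variable {K} {L : CochainComplex (ModuleCat.{u} R) ℤ} (φ : K ⟶ L)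

lemma homologyMap_homologyπ_apply (i : ℤ) (c : K.cycles i) :
    HomologicalComplex.homologyMap φ i (K.homologyπ i c) =
      L.homologyπ i (HomologicalComplex.cyclesMap φ i c) := by
  rw [← ModuleCat.comp_apply, ← ModuleCat.comp_apply, HomologicalComplex.homologyπ_naturality]

lemma iCycles_cyclesMap_apply (i : ℤ) (c : K.cycles i) :
    L.iCycles i (HomologicalComplex.cyclesMap φ i c) = φ.f i (K.iCycles i c) := by
  rw [← ModuleCat.comp_apply, ← ModuleCat.comp_apply, HomologicalComplex.cyclesMap_i]

lemma homologyMap_surjective {i : ℤ}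
    (h : ∀ x : L.X (i + 1), L.d (i + 1) (i + 1 + 1) x = 0 →
      ∃ z : K.X (i + 1), K.d (i + 1) (i + 1 + 1) z = 0 ∧
        ∃ y : L.X i, L.d i (i + 1) y = φ.f (i + 1) z - x) :
    Function.Surjective (HomologicalComplex.homologyMap φ (i + 1)) := by
  intro ξ
  obtain ⟨c, rfl⟩ := homologyπ_surjective L _ ξ
  obtain ⟨z, hz, y, hy⟩ := h (L.iCycles _ c) (d_iCycles_apply L _ _ c)
  obtain ⟨e, rfl⟩ := exists_iCycles_eq K z hz
  refine ⟨K.homologyπ _ e, ?_⟩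
  rw [homologyMap_homologyπ_apply, ← sub_eq_zero, ← map_sub, homologyπ_eq_zero_iff]
  exact ⟨y, by rw [hy, map_sub, iCycles_cyclesMap_apply]⟩

lemma homologyMap_injective {i : ℤ}
    (h : ∀ z : K.X (i + 1), K.d (i + 1) (i + 1 + 1) z = 0 →
      (∃ y : L.X i, L.d i (i + 1) y = φ.f (i + 1) z) → ∃ y : K.X i, K.d i (i + 1) y = z) :
    Function.Injective (HomologicalComplex.homologyMap φ (i + 1)) := by
  rw [injective_iff_map_eq_zero]
  intro ξ hξ
  obtain ⟨c, rfl⟩ := homologyπ_surjective K _ ξ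
  rw [homologyMap_homologyπ_apply, homologyπ_eq_zero_iff, iCycles_cyclesMap_apply] at hξ
  rw [homologyπ_eq_zero_iff]
  exact h _ (d_iCycles_apply K _ _ c) hξ

end Elements

/-! ### Complexes with zero differential and their splittings -/

section ZeroComplex

variable {R : Type u} [CommRing R]

/-- The complex with zero differential and given terms. -/
def zeroComplex (A : ℤ → ModuleCat.{u} R) : CochainComplex (ModuleCat.{u} R) ℤ where
  X := A
  d _ _ := 0

/-- A family of cycles defines a morphism from a complex with zero differential. -/
def zeroComplexDesc {A : ℤ → ModuleCat.{u} R} {K : CochainComplex (ModuleCat.{u} R) ℤ}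
    (α : ∀ i, A i ⟶ K.X i) (hα : ∀ i j, α i ≫ K.d i j = 0) : zeroComplex A ⟶ K where
  f := α
  comm' i j _ := (hα i j).trans zero_comp.symm

/-- A family of maps vanishing on boundaries defines a morphism to a complex with zero
differential. -/
def zeroComplexLift {A : ℤ → ModuleCat.{u} R} {K : CochainComplex (ModuleCat.{u} R) ℤ}
    (α : ∀ i, K.X i ⟶ A i) (hα : ∀ i j, K.d i j ≫ α j = 0) : K ⟶ zeroComplex A where
  f := α
  comm' i j _ := comp_zero.trans (hα i j).symm

/-- The part of a family of modules indexed by a predicate. -/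
def restrictFamily (A : ℤ → ModuleCat.{u} R) (p : ℤ → Prop) (i : ℤ) : ModuleCat.{u} R :=
  ModuleCat.of R (PLift (p i) → A i)

/-- The exponent `PLift (p i)` is a point or empty, so the power is `A i` or zero without a case
distinction between types. -/
lemma restrictFamily_equiv_of_pos (A : ℤ → ModuleCat.{u} R) {p : ℤ → Prop} {i : ℤ} (h : p i) :
    Nonempty (A i ≃ₗ[R] restrictFamily A p i) :=
  have : Unique (PLift (p i)) := ⟨⟨⟨h⟩⟩, fun _ ↦ rfl⟩
  ⟨(LinearEquiv.funUnique (PLift (p i)) R (A i)).symm⟩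

lemma restrictFamily_subsingleton_of_neg (A : ℤ → ModuleCat.{u} R) {p : ℤ → Prop} {i : ℤ}
    (h : ¬ p i) : Subsingleton (restrictFamily A p i) :=
  ⟨fun x y ↦ by
    have hxy : (x : PLift (p i) → A i) = y := funext fun h' ↦ (h h'.down).elim
    exact hxy⟩

lemma restrictFamily_subsingleton (A : ℤ → ModuleCat.{u} R) (p : ℤ → Prop) {i : ℤ}
    (h : Subsingleton (A i)) : Subsingleton (restrictFamily A p i) :=
  ⟨fun x y ↦ by
    have hxy : (x : PLift (p i) → A i) = y := funext fun h' ↦ Subsingleton.elim _ _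
    exact hxy⟩

section

variable (q : Prop) (M : Type u) [AddCommGroup M] [Module R M]

/-- The diagonal map to a power of a module indexed by a proposition. -/
def toPropPower : M →ₗ[R] (PLift q → M) :=
  LinearMap.pi fun _ ↦ LinearMap.id

open Classical in
/-- The map from a power of a module indexed by a proposition that is the evaluation if the
proposition holds and zero otherwise. -/
noncomputable def ofPropPower : (PLift q → M) →ₗ[R] M :=
  if h : q then LinearMap.proj (φ := fun _ : PLift q ↦ M) ⟨h⟩ else 0

variable {q M}

lemma toPropPower_ofPropPower (x : PLift q → M) :
    toPropPower (R := R) q M (ofPropPower (R := R) q M x) = x := by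
  funext h
  simp [toPropPower, ofPropPower, h.down]

lemma ofPropPower_toPropPower_of_pos (h : q) (x : M) :
    ofPropPower (R := R) q M (toPropPower (R := R) q M x) = x := by
  simp [toPropPower, ofPropPower, h]

lemma ofPropPower_of_neg (h : ¬ q) (x : PLift q → M) : ofPropPower (R := R) q M x = 0 := by
  simp [ofPropPower, h]

lemma toPropPower_ofPropPower_not {q' : Prop} (h : q → ¬ q') (x : PLift q' → M) :
    toPropPower (R := R) q M (ofPropPower (R := R) q' M x) = 0 := by
  funext hq
  simp [toPropPower, ofPropPower, h hq.down]

end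

/-- The projection onto a part of a family of modules. -/
def restrictFamilyProj (A : ℤ → ModuleCat.{u} R) (p : ℤ → Prop) (i : ℤ) :
    A i ⟶ restrictFamily A p i :=
  ModuleCat.ofHom (toPropPower (p i) (A i))

/-- The inclusion of a part of a family of modules. -/
noncomputable def restrictFamilyIncl (A : ℤ → ModuleCat.{u} R) (p : ℤ → Prop) (i : ℤ) :
    restrictFamily A p i ⟶ A i :=
  ModuleCat.ofHom (ofPropPower (p i) (A i))

lemma restrictFamilyIncl_proj (A : ℤ → ModuleCat.{u} R) (p : ℤ → Prop) (i : ℤ) :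
    restrictFamilyIncl A p i ≫ restrictFamilyProj A p i = 𝟙 _ :=
  ModuleCat.hom_ext (LinearMap.ext fun x ↦ toPropPower_ofPropPower (R := R) (M := A i) x)

lemma restrictFamilyIncl_proj_not (A : ℤ → ModuleCat.{u} R) {p q : ℤ → Prop} {i : ℤ}
    (hpq : p i → ¬ q i) : restrictFamilyIncl A q i ≫ restrictFamilyProj A p i = 0 :=
  ModuleCat.hom_ext (LinearMap.ext fun x ↦ toPropPower_ofPropPower_not (R := R) (M := A i) hpq x)

/-- A complex with zero differential splits according to a predicate on the degrees. -/
noncomputable def zeroComplexBicone (A : ℤ → ModuleCat.{u} R) (p : ℤ → Prop) :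
    BinaryBicone (zeroComplex (restrictFamily A p))
      (zeroComplex (restrictFamily A fun i ↦ ¬ p i)) where
  pt := zeroComplex A
  fst := zeroComplexDesc (K := zeroComplex _) (restrictFamilyProj A p) fun _ _ ↦ comp_zero
  snd := zeroComplexDesc (K := zeroComplex _) (restrictFamilyProj A _) fun _ _ ↦ comp_zero
  inl := zeroComplexDesc (K := zeroComplex _) (restrictFamilyIncl A p) fun _ _ ↦ comp_zero
  inr := zeroComplexDesc (K := zeroComplex _) (restrictFamilyIncl A _) fun _ _ ↦ comp_zero
  inl_fst := HomologicalComplex.hom_ext _ _ fun i ↦ restrictFamilyIncl_proj A p i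
  inl_snd := HomologicalComplex.hom_ext _ _ fun _ ↦ restrictFamilyIncl_proj_not A id
  inr_fst := HomologicalComplex.hom_ext _ _ fun _ ↦ restrictFamilyIncl_proj_not A not_not.2
  inr_snd := HomologicalComplex.hom_ext _ _ fun i ↦ restrictFamilyIncl_proj A _ i

lemma nonempty_zeroComplex_iso_biprod (A : ℤ → ModuleCat.{u} R) (p : ℤ → Prop) :
    Nonempty (zeroComplex A ≅ zeroComplex (restrictFamily A p) ⊞
      zeroComplex (restrictFamily A fun i ↦ ¬ p i)) := by
  have h : (zeroComplexBicone A p).IsBilimit := by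
    refine isBinaryBilimitOfTotal _ (HomologicalComplex.hom_ext _ _ fun i ↦
      ModuleCat.hom_ext (LinearMap.ext fun (x : A i) ↦ ?_))
    change ofPropPower (R := R) (p i) (A i) (toPropPower (R := R) (p i) (A i) x) +
      ofPropPower (R := R) (¬ p i) (A i) (toPropPower (R := R) (¬ p i) (A i) x) = x
    by_cases h : p i
    · rw [ofPropPower_toPropPower_of_pos h, ofPropPower_of_neg (not_not.2 h), add_zero]
    · rw [ofPropPower_of_neg h, zero_add, ofPropPower_toPropPower_of_pos h]
  exact ⟨biprod.uniqueUpToIso _ _ h⟩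

end ZeroComplex

/-! ### Complexes with zero differential are built from Gorenstein projectives -/

section Built

variable {R : Type u} [CommRing R] [HasDerivedCategory.{w} (ModuleCat.{u} R)]

lemma binaryProductsClosure_biprod {T : Type u} [Category.{v} T] [Preadditive T]
    [HasBinaryBiproducts T] {P : ObjectProperty T} {X Y : T}
    (hX : P.binaryProductsClosure X) (hY : P.binaryProductsClosure Y) :
    P.binaryProductsClosure (X ⊞ Y) :=
  ObjectProperty.prop_of_isLimit_binaryFan _ (BinaryBiproduct.isLimit X Y) hX hY

lemma shiftClosure_singleFunctor {G : ModuleCat.{u} R} (hG : fgGorensteinProjective R G) (i : ℤ) :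
    ((gorensteinProjectiveClass R).shiftClosure ℤ)
      ((DerivedCategory.singleFunctor (ModuleCat.{u} R) i).obj G) :=
  ⟨_, -i, (((DerivedCategory.singleFunctors (ModuleCat.{u} R)).shiftIso (-i) i 0
    (by simp)).app G).symm, ObjectProperty.prop_map_obj _ _ hG⟩

variable [IsNoetherianRing R] {d : ℕ} (hR : HasInjectiveDimensionLE (ModuleCat.of R R) d)

include hR in
lemma binaryProductsClosure_zeroComplex_of_subsingleton (A : ℤ → ModuleCat.{u} R)
    (hfin : ∀ i, Module.Finite R (A i)) (hA : ∀ i, ExtSelfLE R (A i) 0) (n : ℤ)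
    (hn : ∀ i, i ≠ n → Subsingleton (A i)) :
    ((gorensteinProjectiveClass R).shiftClosure ℤ).binaryProductsClosure
      (DerivedCategory.Q.obj (zeroComplex A)) := by
  have h1 : (zeroComplex A).IsStrictlyGE n := by
    rw [CochainComplex.isStrictlyGE_iff]
    intro i hi
    exact ModuleCat.isZero_iff_subsingleton.2 (hn i (by lia))
  have h2 : (zeroComplex A).IsStrictlyLE n := by
    rw [CochainComplex.isStrictlyLE_iff]
    intro i hi
    exact ModuleCat.isZero_iff_subsingleton.2 (hn i (by lia))
  obtain ⟨G, ⟨e⟩⟩ := CochainComplex.exists_iso_single (zeroComplex A) n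
  let e' : A n ≅ G := (HomologicalComplex.eval _ (ComplexShape.up ℤ) n).mapIso e ≪≫
    HomologicalComplex.singleObjXSelf (ComplexShape.up ℤ) n G
  have hG1 : Module.Finite R G := .equiv e'.toLinearEquiv
  have hG := fgGorensteinProjective_of_extSelfLE hR G ((hA n).of_equiv e'.toLinearEquiv)
  exact ObjectProperty.prop_of_iso _ (DerivedCategory.Q.mapIso e).symm
    (ObjectProperty.le_limitsClosure _ _ _ (shiftClosure_singleFunctor hG n))

include hR in
-- The top degree is split off, leaving a complex supported on a shorter interval.
lemma binaryProductsClosure_zeroComplex (A : ℤ → ModuleCat.{u} R)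
    (hfin : ∀ i, Module.Finite R (A i)) (hA : ∀ i, ExtSelfLE R (A i) 0) (a : ℤ) (n : ℕ)
    (hn : ∀ i, ¬ (a ≤ i ∧ i ≤ a + n) → Subsingleton (A i)) :
    ((gorensteinProjectiveClass R).shiftClosure ℤ).binaryProductsClosure
      (DerivedCategory.Q.obj (zeroComplex A)) := by
  induction n generalizing A with
  | zero =>
    exact binaryProductsClosure_zeroComplex_of_subsingleton hR A hfin hA a
      fun i hi ↦ hn i (by simp; lia)
  | succ n ih =>
    have hfin' (p : ℤ → Prop) (i : ℤ) : Module.Finite R (restrictFamily A p i) := by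
      by_cases h : p i
      · obtain ⟨e⟩ := restrictFamily_equiv_of_pos A h
        exact .equiv e
      · have := restrictFamily_subsingleton_of_neg A h
        infer_instance
    have hA' (p : ℤ → Prop) (i : ℤ) : ExtSelfLE R (restrictFamily A p i) 0 := by
      by_cases h : p i
      · obtain ⟨e⟩ := restrictFamily_equiv_of_pos A h
        exact (hA i).of_equiv e
      · have := restrictFamily_subsingleton_of_neg A h
        exact .of_subsingleton 0
    let p : ℤ → Prop := fun i ↦ i = a + (n + 1 : ℕ)
    have h1 := binaryProductsClosure_zeroComplex_of_subsingleton hR (restrictFamily A p)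
      (hfin' _) (hA' _) (a + (n + 1 : ℕ)) fun i hi ↦ restrictFamily_subsingleton_of_neg A hi
    have h2 := ih (restrictFamily A fun i ↦ ¬ p i) (hfin' _) (hA' _) (by
      intro i hi
      by_cases h : p i
      · exact restrictFamily_subsingleton_of_neg A (not_not.2 h)
      · exact restrictFamily_subsingleton A _ (hn i (by grind)))
    obtain ⟨e⟩ := nonempty_zeroComplex_iso_biprod A p
    have := preservesBinaryBiproducts_of_preservesBiproducts
      (DerivedCategory.Q (C := ModuleCat.{u} R))
    exact ObjectProperty.prop_of_iso _ (DerivedCategory.Q.mapIso e ≪≫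
      DerivedCategory.Q.mapBiprod _ _).symm (binaryProductsClosure_biprod h1 h2)

include hR in
/-- A bounded complex with zero differential whose terms are finitely generated and have no
higher `Ext` into the ring is built from finitely generated Gorenstein projective modules. -/
lemma built_zeroComplex (A : ℤ → ModuleCat.{u} R)
    (hfin : ∀ i, Module.Finite R (A i)) (hA : ∀ i, ExtSelfLE R (A i) 0) (a b : ℤ)
    (hab : ∀ i, ¬ (a ≤ i ∧ i ≤ b) → Subsingleton (A i)) :
    built (gorensteinProjectiveClass R) (DerivedCategory.Q.obj (zeroComplex A)) :=
  ObjectProperty.le_retractClosure _ _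
    -- If `b < a`, the complex is zero and is treated as concentrated in degree `a`.
    (binaryProductsClosure_zeroComplex hR A hfin hA a (b - a).toNat fun i hi ↦ hab i (by lia))

end Built

/-! ### Extensions in a triangulated category -/

section Thick

open scoped ZeroObject

variable {T : Type u} [Category.{v} T] [HasZeroObject T] [HasShift T ℤ] [Preadditive T]
  [∀ n : ℤ, (shiftFunctor T n).Additive] [Pretriangulated T] {C : ObjectProperty T}

open Pretriangulated in
-- The auxiliary summand `L` in the definition of `thick` is taken to be zero.
lemma thick_of_distinguished {K M N : T} {f : K ⟶ M} {g : M ⟶ N} {h : N ⟶ K⟦(1 : ℤ)⟧}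
    (hT : Triangle.mk f g h ∈ distinguishedTriangles) {n : ℕ} (hK : built C K)
    (hN : thick C (n + 1) N) : thick C (n + 2) M := by
  let e : (0 : T) ⊞ M ≅ M :=
    { hom := biprod.snd
      inv := biprod.inr
      hom_inv_id := biprod.hom_ext' _ _ ((isZero_zero T).eq_of_src _ _) (by simp)
      inv_hom_id := by simp }
  refine ⟨K, 0, N, f ≫ e.inv, e.hom ≫ g, h, ?_, hK, hN⟩
  refine isomorphic_distinguished _ hT _ ?_
  refine Triangle.isoMk _ _ (Iso.refl _) e (Iso.refl _) ?_ ?_ ?_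
  · change (f ≫ e.inv) ≫ e.hom = 𝟙 K ≫ f
    simp
  · change (e.hom ≫ g) ≫ 𝟙 N = e.hom ≫ g
    simp
  · change h ≫ (shiftFunctor T (1 : ℤ)).map (𝟙 K) = 𝟙 N ≫ h
    simp

end Thick

/-! ### Bounded resolutions by finitely generated modules -/

section Resolution

/-- Recursion downwards on the integers, starting above `b`. -/
noncomputable def descendingChain {P : ℤ → Type*} (b : ℤ) (z : ∀ i, b < i → P i)
    (step : ∀ i, P (i + 1) → P i) (i : ℤ) : P i :=
  if h : b < i then z i h else step i (descendingChain b z step (i + 1))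
termination_by (b + 1 - i).toNat
decreasing_by lia

/-- Terms above `b` are compatible with every successor, which gives the downward recursion a
starting point. -/
lemma exists_descendingChain {P : ℤ → Type*} (r : ∀ i, P i → P (i + 1) → Prop) (b : ℤ)
    (z : ∀ i, b < i → P i) (hz : ∀ i hi y, r i (z i hi) y) (h : ∀ i y, i ≤ b → ∃ x, r i x y) :
    ∃ T : ∀ i, P i, ∀ i, r i (T i) (T (i + 1)) := by
  have h' : ∀ i y, ∃ x, r i x y := by
    intro i y
    rcases lt_or_ge b i with hi | hi
    · exact ⟨_, hz i hi y⟩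
    · exact h i y hi
  choose step hstep using h'
  refine ⟨descendingChain b z step, fun i ↦ ?_⟩
  rcases lt_or_ge b i with hi | hi
  · have : descendingChain b z step i = z i hi := by
      rw [descendingChain, dif_pos hi]
    rw [this]
    exact hz i hi _
  · have : descendingChain b z step i = step i (descendingChain b z step (i + 1)) := by
      rw [descendingChain, dif_neg (not_lt.2 hi)]
    rw [this]
    exact hstep i _

variable {R : Type u} [CommRing R]

/-- A term of a resolution of the complex `X`, together with the submodule of its cycles. -/
structure ResolutionTerm (X : CochainComplex (ModuleCat.{u} R) ℤ) (b i : ℤ) where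
  A : ModuleCat.{u} R
  φ : A →ₗ[R] X.X i
  Z : Submodule R A
  finite : Module.Finite R A
  subsingleton : b < i → Subsingleton A

variable {X : CochainComplex (ModuleCat.{u} R) ℤ} {b : ℤ}

/-- The cycles that have to become boundaries in the next step of a resolution. -/
def ResolutionTerm.bdry {i : ℤ} (T : ResolutionTerm X b (i + 1)) : Submodule R T.A :=
  T.Z ⊓ (LinearMap.range (X.d i (i + 1)).hom).comap T.φ

/-- The differential between two consecutive terms of a resolution; below degree `a`, it is
injective. -/
structure ResolutionStep (a : ℤ) {i : ℤ} (S : ResolutionTerm X b i)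
    (T : ResolutionTerm X b (i + 1)) where
  δ : S.A →ₗ[R] T.A
  range_δ : LinearMap.range δ = T.bdry
  ker_δ : LinearMap.ker δ = S.Z
  comm : ∀ x, T.φ (δ x) = X.d i (i + 1) (S.φ x)
  projective : a ≤ i → Module.Projective R S.A
  injective : i < a → Function.Injective δ
  exists_cycle : ∀ ξ : X.X i, X.d i (i + 1) ξ = 0 → ∃ z ∈ S.Z, ∀ j, j + 1 = i →
    ∃ y : X.X j, X.d j i y = S.φ z - ξ

/-- Where `X` vanishes, the remaining cycles are killed at once by including them as a term. This
truncates the resolution, at the price of a possibly nonprojective term on which the differential is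
injective. -/
lemma exists_resolutionStep_of_lt (a : ℤ) (hX : ∀ i, i < a → Subsingleton (X.X i)) {i : ℤ}
    (hi : i < a) (hib : i ≤ b) (T : ResolutionTerm X b (i + 1)) [IsNoetherianRing R] :
    ∃ S : ResolutionTerm X b i, Nonempty (ResolutionStep a S T) := by
  have := hX i hi
  have := T.finite
  exact ⟨{
    A := ModuleCat.of R T.bdry
    φ := 0
    Z := ⊥
    finite := inferInstanceAs (Module.Finite R T.bdry)
    subsingleton h := absurd hib (not_le.2 h) },
    ⟨{
      δ := T.bdry.subtype
      range_δ := Submodule.range_subtype _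
      ker_δ := Submodule.ker_subtype _
      comm x := by
        obtain ⟨y, hy⟩ := x.2.2
        have hy0 : y = 0 := Subsingleton.elim _ _
        rw [hy0, map_zero] at hy
        change T.φ x.1 = X.d i (i + 1) 0
        rw [map_zero]
        exact hy.symm
      projective h := absurd hi (not_lt.2 h)
      injective _ := Submodule.injective_subtype _
      exists_cycle ξ _ := ⟨0, Submodule.zero_mem _, fun j _ ↦
        ⟨0, by rw [map_zero]; exact Subsingleton.elim _ _⟩⟩ }⟩⟩

/-- The new term is `R^m × R^n`: the first factor covers the cycles that must become boundaries, the
second maps by zero and supplies cycles generating the homology of `X`. -/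
lemma exists_resolutionStep_of_le (a : ℤ) [IsNoetherianRing R]
    (hX : ∀ i, Module.Finite R (X.homology i)) {i : ℤ} (hi : a ≤ i) (hib : i ≤ b)
    (T : ResolutionTerm X b (i + 1)) :
    ∃ S : ResolutionTerm X b i, Nonempty (ResolutionStep a S T) := by
  have := T.finite
  have := hX i
  obtain ⟨m, p, hp⟩ := Module.Finite.exists_fin' R T.bdry
  obtain ⟨n, c, hc⟩ := Module.Finite.exists_fin' R (X.homology i)
  obtain ⟨c', hc'⟩ := Module.projective_lifting_property (X.homologyπ i).hom c
    (homologyπ_surjective X i)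
  let q : T.bdry →ₗ[R] LinearMap.range (X.d i (i + 1)).hom :=
    (T.φ ∘ₗ T.bdry.subtype).codRestrict _ fun x ↦ x.2.2
  obtain ⟨l, hl⟩ := Module.projective_lifting_property (X.d i (i + 1)).hom.rangeRestrict (q ∘ₗ p)
    (LinearMap.surjective_rangeRestrict _)
  have hl' : ∀ x, X.d i (i + 1) (l x) = T.φ (p x) := fun x ↦
    congrArg Subtype.val (LinearMap.congr_fun hl x)
  let δ : ((Fin m → R) × (Fin n → R)) →ₗ[R] T.A := T.bdry.subtype ∘ₗ p ∘ₗ LinearMap.fst R _ _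
  let φ : ((Fin m → R) × (Fin n → R)) →ₗ[R] X.X i :=
    l.coprod ((X.iCycles i).hom ∘ₗ c')
  have hcomm : ∀ x, T.φ (δ x) = X.d i (i + 1) (φ x) := by
    rintro ⟨x, y⟩
    change T.φ (p x) = X.d i (i + 1) (l x + X.iCycles i (c' y))
    rw [map_add, d_iCycles_apply, hl', add_zero]
  exact ⟨{
    A := ModuleCat.of R ((Fin m → R) × (Fin n → R))
    φ := φ
    Z := LinearMap.ker δ
    finite := inferInstanceAs (Module.Finite R ((Fin m → R) × (Fin n → R)))
    subsingleton h := absurd hib (not_le.2 h) },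
    ⟨{
      δ := δ
      range_δ := by
        change LinearMap.range (T.bdry.subtype ∘ₗ p ∘ₗ LinearMap.fst R _ _) = _
        rw [LinearMap.range_comp_of_range_eq_top, Submodule.range_subtype]
        exact LinearMap.range_eq_top.2 (hp.comp LinearMap.fst_surjective)
      ker_δ := rfl
      comm := hcomm
      projective _ := by
        have : Module.Projective R ((Fin m → R) × (Fin n → R)) := inferInstance
        exact this
      injective h := absurd hi (not_le.2 h)
      exists_cycle ξ hξ := by
        obtain ⟨e, rfl⟩ := exists_iCycles_eq X ξ hξ
        obtain ⟨y, hy⟩ := hc (X.homologyπ i e)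
        refine ⟨((0, y) : (Fin m → R) × (Fin n → R)), ?_, ?_⟩
        · change T.bdry.subtype (p 0) = 0
          rw [map_zero, map_zero]
        · rintro j rfl
          have h0 : X.homologyπ (j + 1) (c' y - e) = 0 := by
            rw [map_sub, ← hy, ← hc']
            exact sub_self _
          obtain ⟨w, hw⟩ := (homologyπ_eq_zero_iff X _).1 h0
          refine ⟨w, ?_⟩
          change _ = (l 0 + X.iCycles (j + 1) (c' y)) - _
          rw [hw, map_sub, map_zero, zero_add] }⟩⟩

lemma exists_resolutionStep_of_gt (a : ℤ) (hX : ∀ i, b < i → Subsingleton (X.X i)) {i : ℤ}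
    (hi : b < i) : ∃ S : ResolutionTerm X b i, ∀ T : ResolutionTerm X b (i + 1),
      Nonempty (ResolutionStep a S T) := by
  have := hX i hi
  let S : ResolutionTerm X b i :=
    { A := ModuleCat.of R PUnit.{u + 1}
      φ := 0
      Z := ⊤
      finite := inferInstanceAs (Module.Finite R PUnit.{u + 1})
      subsingleton _ := inferInstanceAs (Subsingleton PUnit.{u + 1}) }
  have hS : Subsingleton S.A := inferInstanceAs (Subsingleton PUnit.{u + 1})
  refine ⟨S, fun T ↦ ?_⟩
  have hT := T.subsingleton (by lia)
  exact ⟨{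
      δ := 0
      range_δ := Subsingleton.elim _ _
      ker_δ := Subsingleton.elim _ _
      comm x := by rw [LinearMap.zero_apply, map_zero, Subsingleton.elim (S.φ x) 0, map_zero]
      projective _ := inferInstanceAs (Module.Projective R PUnit.{u + 1})
      injective _ := Function.injective_of_subsingleton _
      exists_cycle ξ _ := ⟨0, Submodule.zero_mem _, fun j _ ↦
        ⟨0, by rw [map_zero]; exact Subsingleton.elim _ _⟩⟩ }⟩

/-- A bounded complex with finitely generated homology has a bounded resolution by finitely
generated modules that are projective except in the lowest degree, where there is no homology. -/
lemma exists_resolution [IsNoetherianRing R] (X : CochainComplex (ModuleCat.{u} R) ℤ) (a b : ℤ)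
    (hX : ∀ i, Module.Finite R (X.homology i)) (ha : ∀ i, i < a → Subsingleton (X.X i))
    (hb : ∀ i, b < i → Subsingleton (X.X i)) :
    ∃ (F : CochainComplex (ModuleCat.{u} R) ℤ) (φ : F ⟶ X), QuasiIso φ ∧
      (∀ i, Module.Finite R (F.X i)) ∧
      (∀ i, Module.Projective R (F.X i) ∨ Function.Injective (F.d i (i + 1))) ∧
      ∀ i, ¬ (a - 1 ≤ i ∧ i ≤ b) → Subsingleton (F.X i) := by
  choose z hz using fun i (hi : b < i) ↦ exists_resolutionStep_of_gt (b := b) a hb hi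
  obtain ⟨T, hT⟩ := exists_descendingChain
    (r := fun i (S : ResolutionTerm X b i) T ↦ Nonempty (ResolutionStep a S T)) b z
    (fun i hi y ↦ hz i hi y) (fun i y hib ↦ by
      rcases lt_or_ge i a with hi | hi
      · exact exists_resolutionStep_of_lt a ha hi hib y
      · exact exists_resolutionStep_of_le a hX hi hib y)
  let D (i : ℤ) : ResolutionStep a (T i) (T (i + 1)) := (hT i).some
  have hsq : ∀ i x, (D (i + 1)).δ ((D i).δ x) = 0 := by
    intro i x
    have h1 : (D i).δ x ∈ (T (i + 1)).bdry := (D i).range_δ ▸ LinearMap.mem_range_self _ x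
    exact LinearMap.mem_ker.1 ((D (i + 1)).ker_δ ▸ h1.1)
  let F : CochainComplex (ModuleCat.{u} R) ℤ := CochainComplex.of (fun i ↦ (T i).A)
    (fun i ↦ ModuleCat.ofHom (D i).δ) fun i ↦ ModuleCat.hom_ext (LinearMap.ext (hsq i))
  have hFd : ∀ i, F.d i (i + 1) = ModuleCat.ofHom (D i).δ := fun i ↦
    CochainComplex.of_d (fun i ↦ (T i).A) (fun i ↦ ModuleCat.ofHom (D i).δ) i
  let φ : F ⟶ X :=
    { f := fun i ↦ ModuleCat.ofHom (T i).φ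
      comm' := by
        rintro i _ rfl
        rw [hFd]
        exact ModuleCat.hom_ext (LinearMap.ext fun x ↦ ((D i).comm x).symm) }
  refine ⟨F, φ, ⟨fun j ↦ ?_⟩, fun i ↦ (T i).finite, fun i ↦ ?_, fun i hi ↦ ?_⟩
  · obtain ⟨i, rfl⟩ : ∃ i, j = i + 1 := ⟨j - 1, by lia⟩
    rw [quasiIsoAt_iff_isIso_homologyMap, ConcreteCategory.isIso_iff_bijective]
    constructor
    · refine homologyMap_injective φ ?_
      rintro x hx ⟨y, hy⟩
      rw [hFd] at hx
      have h1 : x ∈ (T (i + 1)).bdry :=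
        ⟨(D (i + 1)).ker_δ ▸ LinearMap.mem_ker.2 hx, ⟨y, hy⟩⟩
      rw [← (D i).range_δ] at h1
      obtain ⟨w, hw⟩ := h1
      refine ⟨w, ?_⟩
      rw [hFd]
      exact hw
    · refine homologyMap_surjective φ fun x hx ↦ ?_
      obtain ⟨w, hw, h⟩ := (D (i + 1)).exists_cycle x hx
      refine ⟨w, ?_, h i rfl⟩
      rw [hFd]
      rw [← (D (i + 1)).ker_δ] at hw
      exact hw
  · rw [hFd]
    rcases lt_or_ge i a with hi | hi
    · exact Or.inr ((D i).injective hi)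
    · exact Or.inl ((D i).projective hi)
  · rcases lt_or_ge b i with hib | hib
    · exact (T i).subsingleton hib
    · have h1 : LinearMap.range (D i).δ = ⊥ := by
        rw [(D i).range_δ, eq_bot_iff]
        intro x hx
        have h2 : x ∈ LinearMap.ker (D (i + 1)).δ := (D (i + 1)).ker_δ ▸ hx.1
        exact (D (i + 1)).injective (by lia) ((LinearMap.mem_ker.1 h2).trans (map_zero _).symm)
      refine ⟨fun x y ↦ (D i).injective (by lia) ?_⟩
      rw [LinearMap.range_eq_bot.1 h1]
      rfl

end Resolution

/-! ### Cycles, boundaries and the bound on the level -/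

section Level

open DerivedCategory

variable {R : Type u} [CommRing R]

section Cycles

variable (F : CochainComplex (ModuleCat.{u} R) ℤ)

/-- The boundaries of a complex of modules in degree `i + 1`. -/
def boundaries (i : ℤ) : ModuleCat.{u} R :=
  ModuleCat.of R (LinearMap.range (F.d i (i + 1)).hom)

/-- The differential, as a map onto the boundaries. -/
def toBoundaries (i : ℤ) : F.X i ⟶ boundaries F i :=
  ModuleCat.ofHom (F.d i (i + 1)).hom.rangeRestrict

lemma toBoundaries_surjective (i : ℤ) : Function.Surjective (toBoundaries F i).hom :=
  LinearMap.surjective_rangeRestrict _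

lemma iCycles_toBoundaries_exact (i : ℤ) :
    Function.Exact (F.iCycles i).hom (toBoundaries F i).hom := by
  intro x
  rw [← iCycles_exact F i x]
  exact Subtype.ext_iff

lemma d_toBoundaries (i j : ℤ) : F.d i j ≫ toBoundaries F j = 0 := by
  refine ModuleCat.hom_ext (LinearMap.ext fun x ↦ Subtype.ext ?_)
  exact LinearMap.congr_fun (congrArg ModuleCat.Hom.hom (F.d_comp_d i j (j + 1))) x

/-- The inclusion of the boundaries into the cycles. -/
noncomputable def boundariesToCycles (i : ℤ) : boundaries F i →ₗ[R] F.cycles (i + 1) :=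
  (LinearEquiv.ofInjective (F.iCycles (i + 1)).hom (iCycles_injective F _)).symm.toLinearMap ∘ₗ
    Submodule.inclusion (by
      rintro _ ⟨x, rfl⟩
      refine exists_iCycles_eq F _ ?_
      exact LinearMap.congr_fun (congrArg ModuleCat.Hom.hom (F.d_comp_d i (i + 1) (i + 1 + 1))) x)

lemma iCycles_boundariesToCycles (i : ℤ) (x : boundaries F i) :
    F.iCycles (i + 1) (boundariesToCycles F i x) = x.1 :=
  congrArg Subtype.val (LinearEquiv.apply_symm_apply
    (LinearEquiv.ofInjective (F.iCycles (i + 1)).hom (iCycles_injective F _)) _)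

lemma boundariesToCycles_injective (i : ℤ) : Function.Injective (boundariesToCycles F i) := by
  intro x y h
  have := congrArg (F.iCycles (i + 1)) h
  rw [iCycles_boundariesToCycles, iCycles_boundariesToCycles] at this
  exact Subtype.ext this

lemma boundariesToCycles_exact (i : ℤ) :
    Function.Exact (boundariesToCycles F i) (F.homologyπ (i + 1)).hom := by
  intro c
  refine (homologyπ_eq_zero_iff F c).trans ⟨?_, ?_⟩
  · rintro ⟨y, hy⟩
    refine ⟨⟨F.d i (i + 1) y, y, rfl⟩, iCycles_injective F _ ?_⟩
    exact (iCycles_boundariesToCycles F i _).trans hy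
  · rintro ⟨x, rfl⟩
    obtain ⟨y, hy⟩ := x.2
    exact ⟨y, hy.trans (iCycles_boundariesToCycles F i x).symm⟩

lemma cycles_subsingleton {i : ℤ} (h : Subsingleton (F.X i)) : Subsingleton (F.cycles i) :=
  (iCycles_injective F i).subsingleton

lemma boundaries_subsingleton {i : ℤ} (h : Subsingleton (F.X i)) : Subsingleton (boundaries F i) :=
  (toBoundaries_surjective F i).subsingleton

/-- The short exact sequence `0 → Z(F) → F → B(F)[1] → 0`. -/
noncomputable def cyclesBoundariesShortComplex :
    ShortComplex (CochainComplex (ModuleCat.{u} R) ℤ) where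
  X₁ := zeroComplex fun i ↦ F.cycles i
  X₂ := F
  X₃ := zeroComplex (boundaries F)
  f := zeroComplexDesc (fun i ↦ F.iCycles i) fun i j ↦ F.iCycles_d i j
  g := zeroComplexLift (toBoundaries F) (d_toBoundaries F)
  zero := HomologicalComplex.hom_ext _ _ fun i ↦ ModuleCat.hom_ext (LinearMap.ext fun x ↦
    (iCycles_toBoundaries_exact F i).apply_apply_eq_zero x)

lemma cyclesBoundariesShortComplex_shortExact : (cyclesBoundariesShortComplex F).ShortExact :=
  HomologicalComplex.shortExact_of_degreewise_shortExact _ fun i ↦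
    ModuleCat.shortComplex_shortExact _ (iCycles_toBoundaries_exact F i) (iCycles_injective F i)
      (toBoundaries_surjective F i)

/-- If the homology has no `Ext` into the ring above degree `1` and the complex is made of
projective modules, then the cycles have no higher `Ext` into the ring. -/
lemma extSelfLE_cycles (b : ℤ)
    (hF : ∀ i, Module.Projective R (F.X i) ∨ Function.Injective (F.d i (i + 1)))
    (hb : ∀ i, b < i → Subsingleton (F.X i)) (hH : ∀ i, ExtSelfLE R (F.homology i) 1) (i : ℤ) :
    ExtSelfLE R (F.cycles i) 0 ∧ ExtSelfLE R (boundaries F i) 0 := by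
  suffices H : ∀ (n : ℕ) (i : ℤ), b < i + n →
      ExtSelfLE R (F.cycles i) 0 ∧ ExtSelfLE R (boundaries F i) 0 from
    H (b + 1 - i).toNat i (by lia)
  intro n
  induction n with
  | zero =>
    intro i hi
    have h := hb i (by simpa using hi)
    have := cycles_subsingleton F h
    have := boundaries_subsingleton F h
    exact ⟨.of_subsingleton 0, .of_subsingleton 0⟩
  | succ n ih =>
    intro i hi
    -- In `0 → B → Z → H → 0` the bound `1` on `H` becomes `0` on `B`, the cycles one degree up
    -- being already treated.
    have hB : ExtSelfLE R (boundaries F i) 0 :=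
      .of_left (boundariesToCycles_exact F i) (boundariesToCycles_injective F i)
        (homologyπ_surjective F (i + 1)) (ih (i + 1) (by push_cast at hi; lia)).1 (hH (i + 1))
    refine ⟨?_, hB⟩
    -- A projective term makes the cycles a syzygy of the boundaries; where the differential is
    -- injective there are no cycles.
    rcases hF i with hF | hF
    · exact .of_left (iCycles_toBoundaries_exact F i) (iCycles_injective F i)
        (toBoundaries_surjective F i) (.of_projective 0) (hB.mono zero_le_one)
    · have : Subsingleton (F.cycles i) := by
        refine ⟨fun x y ↦ iCycles_injective F i (hF ?_)⟩
        rw [d_iCycles_apply, d_iCycles_apply]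
      exact .of_subsingleton 0

end Cycles

/-- Covering zero by zero keeps families of covers bounded; no minimality is involved. -/
lemma exists_projective_cover (K : Type u) [AddCommGroup K] [Module R K] [Module.Finite R K] :
    ∃ (A : ModuleCat.{u} R) (p : A →ₗ[R] K), Module.Finite R A ∧ Module.Projective R A ∧
      Function.Surjective p ∧ (Subsingleton K → Subsingleton A) := by
  rcases subsingleton_or_nontrivial K with hK | hK
  · exact ⟨ModuleCat.of R PUnit.{u + 1}, 0, inferInstanceAs (Module.Finite R PUnit.{u + 1}),
      inferInstanceAs (Module.Projective R PUnit.{u + 1}),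
      fun x ↦ ⟨0, Subsingleton.elim _ _⟩, fun _ ↦ inferInstanceAs (Subsingleton PUnit.{u + 1})⟩
  · obtain ⟨m, p, hp⟩ := Module.Finite.exists_fin' R K
    exact ⟨ModuleCat.of R (Fin m → R), p, inferInstanceAs (Module.Finite R (Fin m → R)),
      inferInstanceAs (Module.Projective R (Fin m → R)), hp,
      fun h ↦ absurd h (not_subsingleton_iff_nontrivial.2 hK)⟩

variable [HasDerivedCategory.{w} (ModuleCat.{u} R)]

lemma exists_resolution_of_derivedBoundedFinite [IsNoetherianRing R]
    (M : DerivedCategory (ModuleCat.{u} R)) (hM : derivedBoundedFinite R M) :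
    ∃ (F : CochainComplex (ModuleCat.{u} R) ℤ) (a b : ℤ), Nonempty (Q.obj F ≅ M) ∧
      (∀ i, Module.Finite R (F.X i)) ∧
      (∀ i, Module.Projective R (F.X i) ∨ Function.Injective (F.d i (i + 1))) ∧
      ∀ i, ¬ (a ≤ i ∧ i ≤ b) → Subsingleton (F.X i) := by
  obtain ⟨⟨a, b, ha, hb⟩, hfin⟩ := hM
  obtain ⟨X, hXa, hXb, ⟨e⟩⟩ := exists_iso_Q_obj_of_isGE_of_isLE M a b
  obtain ⟨F, φ, hφ, h1, h2, h3⟩ := exists_resolution X a b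
    (fun i ↦ by
      have := hfin i
      exact .equiv ((homologyFunctor _ i).mapIso e ≪≫
        (homologyFunctorFactors _ i).app X).toLinearEquiv)
    (fun i hi ↦ ModuleCat.isZero_iff_subsingleton.1 (X.isZero_of_isStrictlyGE a i hi))
    (fun i hi ↦ ModuleCat.isZero_iff_subsingleton.1 (X.isZero_of_isStrictlyLE b i hi))
  have := (isIso_Q_map_iff_quasiIso _ φ).2 hφ
  exact ⟨F, a - 1, b, ⟨asIso (Q.map φ) ≪≫ e.symm⟩, h1, h2, h3⟩

lemma thick_of_iso {T : Type u} [Category.{v} T] [HasZeroObject T] [HasShift T ℤ] [Preadditive T]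
    [∀ n : ℤ, (shiftFunctor T n).Additive] [Pretriangulated T] {C : ObjectProperty T} {X Y : T}
    (e : X ≅ Y) {n : ℕ} (h : thick C (n + 2) X) : thick C (n + 2) Y := by
  obtain ⟨K, L, N, f, g, k, hT, hK, hN⟩ := h
  let e' : L ⊞ X ≅ L ⊞ Y := biprod.mapIso (Iso.refl L) e
  refine ⟨K, L, N, f ≫ e'.hom, e'.inv ≫ g, k, ?_, hK, hN⟩
  refine Pretriangulated.isomorphic_distinguished _ hT _ ?_
  refine Pretriangulated.Triangle.isoMk _ _ (Iso.refl _) e'.symm (Iso.refl _) ?_ ?_ ?_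
  · change (f ≫ e'.hom) ≫ e'.inv = 𝟙 K ≫ f
    simp
  · change (e'.inv ≫ g) ≫ 𝟙 N = e'.inv ≫ g
    simp
  · change k ≫ (shiftFunctor T (1 : ℤ)).map (𝟙 K) = 𝟙 N ≫ k
    simp

variable [IsNoetherianRing R] {d : ℕ} (hR : HasInjectiveDimensionLE (ModuleCat.of R R) d)

include hR in
/-- A complex whose homology has no `Ext` into the ring above degree `1` has level at most `2`. -/
lemma thick_two_of_extSelfLE_one (M : DerivedCategory (ModuleCat.{u} R))
    (hM : derivedBoundedFinite R M)
    (hH : ∀ i, ExtSelfLE R ((homologyFunctor (ModuleCat.{u} R) i).obj M) 1) :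
    thick (gorensteinProjectiveClass R) 2 M := by
  obtain ⟨F, a, b, ⟨e⟩, hfin, hproj, hab⟩ := exists_resolution_of_derivedBoundedFinite M hM
  have hZB := extSelfLE_cycles F b hproj (fun i hi ↦ hab i (by lia)) fun i ↦
    (hH i).of_equiv ((homologyFunctor _ i).mapIso e.symm ≪≫
      (homologyFunctorFactors _ i).app F).toLinearEquiv
  refine thick_of_iso e (n := 0) (thick_of_distinguished
    (triangleOfSES_distinguished (cyclesBoundariesShortComplex_shortExact F)) ?_ ?_)
  · exact built_zeroComplex hR (fun i ↦ F.cycles i)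
      (fun i ↦ Module.Finite.of_injective (F.iCycles i).hom (iCycles_injective F i))
      (fun i ↦ (hZB i).1) a b fun i hi ↦ cycles_subsingleton F (hab i hi)
  · exact built_zeroComplex hR (boundaries F)
      (fun i ↦ Module.Finite.of_surjective (toBoundaries F i).hom (toBoundaries_surjective F i))
      (fun i ↦ (hZB i).2) a b fun i hi ↦ boundaries_subsingleton F (hab i hi)

/-- The homology of a complex with zero differential. -/
noncomputable def zeroComplexHomologyIso (A : ℤ → ModuleCat.{u} R) (i : ℤ) :
    A i ≅ (homologyFunctor (ModuleCat.{u} R) i).obj (Q.obj (zeroComplex A)) :=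
  ((zeroComplex A).iCyclesIso i (i + 1) (by simp) rfl).symm ≪≫
    (zeroComplex A).isoHomologyπ (i - 1) i (by simp) rfl ≪≫
    ((homologyFunctorFactors _ i).app (zeroComplex A)).symm

omit [IsNoetherianRing R] in
lemma homologyFunctor_map_Q_surjective {F G : CochainComplex (ModuleCat.{u} R) ℤ} (φ : F ⟶ G)
    (i : ℤ) (hφ : Function.Surjective (HomologicalComplex.homologyMap φ i)) :
    Function.Surjective ((homologyFunctor (ModuleCat.{u} R) i).map (Q.map φ)) := by
  intro x
  obtain ⟨y, hy⟩ := hφ (((homologyFunctorFactors (ModuleCat.{u} R) i).app G).hom x)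
  obtain ⟨z, rfl⟩ :=
    ((homologyFunctorFactors (ModuleCat.{u} R) i).app F).toLinearEquiv.surjective y
  refine ⟨z, ((homologyFunctorFactors (ModuleCat.{u} R) i).app G).toLinearEquiv.injective
    (Eq.trans ?_ hy)⟩
  exact LinearMap.congr_fun (congrArg ModuleCat.Hom.hom
    ((homologyFunctorFactors (ModuleCat.{u} R) i).hom.naturality φ)) z

include hR in
/-- Every object with bounded finitely generated homology receives a morphism from an object built
from free modules that is surjective on homology. -/
lemma exists_built_homology_surjective (M : DerivedCategory (ModuleCat.{u} R))
    (hM : derivedBoundedFinite R M) :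
    ∃ (P : DerivedCategory (ModuleCat.{u} R)) (f : P ⟶ M) (a b : ℤ),
      built (gorensteinProjectiveClass R) P ∧
      ∀ i, Module.Finite R ((homologyFunctor (ModuleCat.{u} R) i).obj P) ∧
        Module.Projective R ((homologyFunctor (ModuleCat.{u} R) i).obj P) ∧
        Function.Surjective ((homologyFunctor (ModuleCat.{u} R) i).map f) ∧
        (¬ (a ≤ i ∧ i ≤ b) →
          Subsingleton ((homologyFunctor (ModuleCat.{u} R) i).obj P)) := by
  obtain ⟨F, a, b, ⟨e⟩, hfin, -, hab⟩ := exists_resolution_of_derivedBoundedFinite M hM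
  have hZ : ∀ i, Module.Finite R (F.cycles i) := fun i ↦
    Module.Finite.of_injective (F.iCycles i).hom (iCycles_injective F i)
  choose A p hA hA' hp hsub using fun i ↦ exists_projective_cover (R := R) (F.cycles i)
  -- The covers land in cycles, so they form a chain map from the complex with zero differential,
  -- and every homology class is hit.
  let φ : zeroComplex A ⟶ F := zeroComplexDesc (fun i ↦ ModuleCat.ofHom (p i) ≫ F.iCycles i)
    fun i j ↦ by rw [Category.assoc, F.iCycles_d, comp_zero]
  have hφ : ∀ i, Function.Surjective (HomologicalComplex.homologyMap φ i) := by
    intro j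
    obtain ⟨i, rfl⟩ : ∃ i, j = i + 1 := ⟨j - 1, by lia⟩
    refine homologyMap_surjective φ fun x hx ↦ ?_
    obtain ⟨c, rfl⟩ := exists_iCycles_eq F x hx
    obtain ⟨y, rfl⟩ := hp _ c
    exact ⟨y, rfl, 0, by rw [map_zero]; exact (sub_self _).symm⟩
  refine ⟨_, Q.map φ ≫ e.hom, a, b, built_zeroComplex hR A hA
    (fun i ↦ .of_projective 0) a b (fun i hi ↦ hsub i (cycles_subsingleton F (hab i hi))),
    fun i ↦ ⟨.equiv (zeroComplexHomologyIso A i).toLinearEquiv,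
      .of_equiv (zeroComplexHomologyIso A i).toLinearEquiv, ?_, fun hi ↦ ?_⟩⟩
  · rw [Functor.map_comp]
    exact ((homologyFunctor (ModuleCat.{u} R) i).mapIso e).toLinearEquiv.surjective.comp
      (homologyFunctor_map_Q_surjective φ i (hφ i))
  · have := hsub i (cycles_subsingleton F (hab i hi))
    exact (zeroComplexHomologyIso A i).toLinearEquiv.symm.injective.subsingleton

include hR in
-- Let `N` be the cone of a map `P ⟶ M` that is surjective on homology, `P` having projective
-- homology. Then `H^i(N)` is the kernel of `H^{i+1}(P) → H^{i+1}(M)`, a first syzygy, so its `Ext`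
-- bound is one lower and induction applies to `N`.
lemma thick_of_extSelfLE (k : ℕ) (M : DerivedCategory (ModuleCat.{u} R))
    (hM : derivedBoundedFinite R M)
    (hH : ∀ i, ExtSelfLE R ((homologyFunctor (ModuleCat.{u} R) i).obj M) (k + 1)) :
    thick (gorensteinProjectiveClass R) (k + 2) M := by
  induction k generalizing M with
  | zero => exact thick_two_of_extSelfLE_one hR M hM hH
  | succ k ih =>
    obtain ⟨P, f, a, b, hP, h⟩ := exists_built_homology_surjective hR M hM
    obtain ⟨N, g, δ, hT⟩ := Pretriangulated.distinguished_cocone_triangle f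
    let T := Pretriangulated.Triangle.mk f g δ
    have hinj : ∀ i, Function.Injective (HomologySequence.δ T i (i + 1)) := by
      intro i
      have hepi : Epi ((homologyFunctor (ModuleCat.{u} R) i).map T.mor₁) :=
        (ModuleCat.epi_iff_surjective _).2 (h i).2.2.1
      have hzero := (HomologySequence.epi_homologyMap_mor₁_iff T hT i).1 hepi
      have hmono := (HomologySequence.exact₃ T hT i (i + 1)).mono_g hzero
      exact (ModuleCat.mono_iff_injective _).1 hmono
    have hexact : ∀ i, Function.Exact (HomologySequence.δ T i (i + 1))
        ((homologyFunctor (ModuleCat.{u} R) (i + 1)).map f) := fun i ↦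
      (ShortComplex.ShortExact.moduleCat_exact_iff_function_exact _).1
        (HomologySequence.exact₁ T hT i (i + 1))
    -- `H^i(N)` embeds in `H^{i+1}(P)`, which moves the lower bound to `a - 1`; `b` remains an upper
    -- bound.
    refine thick_of_distinguished hT hP (ih N ⟨⟨a - 1, b, ?_, ?_⟩, fun i ↦ ?_⟩ fun i ↦ ?_)
    · rw [isGE_iff]
      intro i hi
      have : Subsingleton ((homologyFunctor (ModuleCat.{u} R) (i + 1)).obj T.obj₁) :=
        (h (i + 1)).2.2.2 (by lia)
      exact ModuleCat.isZero_iff_subsingleton.2 (hinj i).subsingleton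
    · rw [isLE_iff]
      intro i hi
      have : Subsingleton ((homologyFunctor (ModuleCat.{u} R) (i + 1)).obj T.obj₁) :=
        (h (i + 1)).2.2.2 (by lia)
      exact ModuleCat.isZero_iff_subsingleton.2 (hinj i).subsingleton
    · have : Module.Finite R ((homologyFunctor (ModuleCat.{u} R) (i + 1)).obj T.obj₁) :=
        (h (i + 1)).1
      exact Module.Finite.of_injective (HomologySequence.δ T i (i + 1)).hom (hinj i)
    · have : Module.Projective R ((homologyFunctor (ModuleCat.{u} R) (i + 1)).obj T.obj₁) :=
        (h (i + 1)).2.1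
      exact .of_left (f := (HomologySequence.δ T i (i + 1)).hom) (hexact i) (hinj i)
        (h (i + 1)).2.2.1 (.of_projective _) (hH (i + 1))

end Level

/-! ### The bound in terms of the Krull dimension -/

theorem mainTheorem2 (R : Type u) [CommRing R] [IsNoetherianRing R]
    [HasDerivedCategory.{w} (ModuleCat.{u} R)] (hR : IsGorensteinRing R)
    (M : DerivedCategory (ModuleCat.{u} R)) (hM : derivedBoundedFinite R M) :
    ((gLevel M : ℕ∞) : WithBot ℕ∞) ≤ max 2 (ringKrullDim R + 1) := by
  have key : ∀ k : ℕ, ringKrullDim R ≤ (k + 1 : ℕ) → gLevel M ≤ (k + 2 : ℕ) := by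
    intro k hk
    have hinj := hR.hasInjectiveDimensionLE hk
    exact iInf₂_le (k + 2) (thick_of_extSelfLE hinj k M hM fun i j hj ↦
      extZero_of_hasInjectiveDimensionLE hj)
  rcases lt_or_ge 1 (ringKrullDim R) with h1 | h1
  · refine le_trans ?_ (le_max_right _ _)
    have hbot : ringKrullDim R ≠ ⊥ := by
      intro h
      rw [h] at h1
      exact not_lt_bot h1
    obtain ⟨s, hs⟩ := WithBot.ne_bot_iff_exists.1 hbot
    rw [← hs] at h1 ⊢
    rcases eq_or_ne s ⊤ with rfl | hs'
    · exact_mod_cast le_top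
    · lift s to ℕ using hs'
      have h1' : 1 < s := by exact_mod_cast h1
      obtain ⟨k, rfl⟩ : ∃ k, s = k + 1 := ⟨s - 1, by lia⟩
      exact_mod_cast key k hs.symm.le
  -- Dimension at most `1` includes the zero ring, whose dimension is `⊥`; `k = 0` suffices.
  · refine le_trans ?_ (le_max_left _ _)
    have h : gLevel M ≤ 2 := key 0 (by simpa using h1)
    exact WithBot.coe_le_coe.2 h
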